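/- \textbf{Conventions.} All graphs are simple. A \emph{square} in a graph is an induced $4$-cycle. A connected graph $X$ is \emph{quasi-median} if it contains neither $K_4^-$ (the complete graph on four vertices minus an edge) nor $K_{3,2}$ as an induced subgraph, and satisfies: (triangle condition) for all vertices $a,x,y$ with $x,y$ adjacent and $d(a,x)=d(a,y)$, there is a common neighbour $z$ of $x,y$ with $d(a,z)=d(a,x)-1$; (quadrangle condition) for all vertices $a,x,y,z$ with $x \neq y$ both adjacent to $z$ and $d(a,x)=d(a,y)=d(a,z)-1$, there is a common neighbour $w$ of $x,y$ with $d(a,w)=d(a,z)-2$. A \emph{hyperplane} $J$ of $X$ is an equivalence class of edges for the equivalence relation generated by: two edges are related if they lie in a common triangle or are opposite sides of a square. The \emph{carrier} $N(J)$ is the subgraph generated by the edges of $J$. The \emph{sectors} delimited by $J$ are the connected components of the graph obtained from $X$ by removing the interiors of the edges of $J$; $\mathscr{S}(J)$ denotes the set of sectors. Two hyperplanes are \emph{transverse} if they contain two edges spanning a square (i.e.\ two adjacent sides of a square), and two distinct hyperplanes are \emph{tangent} if they are not transverse but their carriers intersect. If a group $G$ acts on $X$ by graph automorphisms, $\mathfrak{S}(J)$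 denotes the image of $\mathrm{stab}_G(J)$ in the group of permutations of $\mathscr{S}(J)$. The action is \emph{special} if it is faithful and: for every hyperplane $J$ and every $g \in G$, $J$ and $gJ$ are neither transverse nor tangent; for all hyperplanes $J_1,J_2$ and every $g \in G$, if $J_1$ and $J_2$ are transverse then $J_1$ and $gJ_2$ are not tangent; and for every hyperplane $J$, the action of $\mathfrak{S}(J)$ on $\mathscr{S}(J)$ is free. For a graph $\Gamma$ and groups $\mathcal{G}=\{G_u \mid u \in V(\Gamma)\}$, the \emph{graph product} $\Gamma\mathcal{G}$ is the quotient of the free product of the $G_u$ by the normal closure of the commutators $[g,h]$ with $g \in G_u$, $h \in G_v$ and $u,v$ adjacent in $\Gamma$; and $\mathrm{QM}(\Gamma,\mathcal{G})$ is the Cayley graph of $\Gamma\mathcal{G}$ with respect to $\bigcup_u G_u\setminus\{1\}$, on which $\Gamma\mathcal{G}$ acts by left multiplication. A set $Y$ of vertices of a graph (equivalently, the subgraph it induces) is \emph{gated} if for every vertex $x$ there is $y \in Y$ such that, for every $z \in Y$, some geodesic from $x$ to $z$ passes through $y$. \textbf{Theorem.} Let $G$ be a group acting specially on a quasi-median graph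 $X$ (no finiteness of the number of orbits is assumed). Fix representatives $\{J_i \mid i \in I\}$ of the hyperplanes of $X$ modulo the action of $G$. Let $\Gamma$ be the graph with vertex-set $\{J_i \mid i \in I\}$ in which two distinct vertices are joined by an edge if they have transverse $G$-translates. For every $i \in I$, let $G_i = \mathfrak{S}(J_i) \oplus K_i$, where $K_i$ is an arbitrary group whose cardinality is the number of orbits of $\mathfrak{S}(J_i)$ acting on $\mathscr{S}(J_i)$, and let $\mathcal{G}=\{G_i \mid i \in I\}$. Then there exist an injective morphism $\varphi : G \hookrightarrow \Gamma\mathcal{G}$ and a graph embedding $\Phi : X \hookrightarrow \mathrm{QM}(\Gamma,\mathcal{G})$ (onto an induced subgraph) which is isometric, $\varphi$-equivariant (i.e.\ $\Phi(gx)=\varphi(g)\Phi(x)$ for all $g \in G$ and all vertices $x$), and whose image is gated. -/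

import Mathlib

namespace QuasiMedian

/-! ### Quasi-median graphs -/

section Graphs

variable {V : Type*}

/-- The complete graph on four vertices minus an edge. -/
def K4Minus : SimpleGraph (Fin 4) := (⊤ : SimpleGraph (Fin 4)).deleteEdges {s(0, 1)}

/-- For all vertices `a, x, y` with `x, y` adjacent and `d(a,x) = d(a,y)` there is a common
neighbour `z` of `x` and `y` with `d(a,z) = d(a,x) - 1`. -/
def TriangleCondition (X : SimpleGraph V) : Prop :=
  ∀ a x y : V, X.Adj x y → X.dist a x = X.dist a y →
    ∃ z : V, X.Adj z x ∧ X.Adj z y ∧ X.dist a z + 1 = X.dist a x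

/-- For all vertices `a, x, y, z` with `x ≠ y` both adjacent to `z` and
`d(a,x) = d(a,y) = d(a,z) - 1` there is a common neighbour `w` of `x` and `y` with
`d(a,w) = d(a,z) - 2`. -/
def QuadrangleCondition (X : SimpleGraph V) : Prop :=
  ∀ a x y z : V, x ≠ y → X.Adj z x → X.Adj z y →
    X.dist a x + 1 = X.dist a z → X.dist a y + 1 = X.dist a z →
      ∃ w : V, X.Adj w x ∧ X.Adj w y ∧ X.dist a w + 2 = X.dist a z

/-- Quasi-median graphs. -/
structure IsQuasiMedian (X : SimpleGraph V) : Prop where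
  connected : X.Connected
  no_K4Minus : ¬ SimpleGraph.IsIndContained K4Minus X
  no_K32 : ¬ SimpleGraph.IsIndContained (completeBipartiteGraph (Fin 3) (Fin 2)) X
  triangle : TriangleCondition X
  quadrangle : QuadrangleCondition X

/-- `y` is a gate of `x` in `Y`: it lies in `Y`, and every `z ∈ Y` is joined to `x` by a geodesic
passing through `y`. -/
def IsGate (X : SimpleGraph V) (Y : Set V) (x y : V) : Prop :=
  y ∈ Y ∧ ∀ z ∈ Y, ∃ p : X.Walk x z, p.length = X.dist x z ∧ y ∈ p.support

/-- The subgraph with vertex-set `Y` is gated: every vertex of `X` has a gate in `Y`. -/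
def IsGated (X : SimpleGraph V) (Y : Set V) : Prop :=
  ∀ x : V, ∃ y : V, IsGate X Y x y

/-! ### Hyperplanes and sectors -/

/-- `a, b, c, d` are the consecutive vertices of an (induced) square. -/
structure IsSquare (X : SimpleGraph V) (a b c d : V) : Prop where
  ab : X.Adj a b
  bc : X.Adj b c
  cd : X.Adj c d
  da : X.Adj d a
  ne_ac : a ≠ c
  ne_bd : b ≠ d
  not_ac : ¬ X.Adj a c
  not_bd : ¬ X.Adj b d

/-- Two edges belong to a common triangle or are opposite sides of a square. -/
def EdgeRel (X : SimpleGraph V) (e f : X.edgeSet) : Prop :=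
  (∃ a b c : V, X.Adj a b ∧ X.Adj b c ∧ X.Adj a c ∧
    (e : Sym2 V) = s(a, b) ∧ (f : Sym2 V) = s(a, c)) ∨
  (∃ a b c d : V, IsSquare X a b c d ∧ (e : Sym2 V) = s(a, b) ∧ (f : Sym2 V) = s(d, c))

/-- A hyperplane is a class of edges for the equivalence relation generated by `EdgeRel`. -/
def Hyperplane (X : SimpleGraph V) : Type _ := Quot (EdgeRel X)

namespace Hyperplane

variable {X : SimpleGraph V}

/-- The edges in (dual to) a hyperplane. -/
def edges (J : Hyperplane X) : Set (Sym2 V) :=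
  {e | ∃ h : e ∈ X.edgeSet, Quot.mk (EdgeRel X) ⟨e, h⟩ = J}

/-- The vertices of the carrier `N(J)`: the endpoints of the edges of `J`. -/
def carrier (J : Hyperplane X) : Set V := {v | ∃ e ∈ J.edges, v ∈ e}

/-- Two hyperplanes are transverse if they contain two edges spanning a square. -/
def Transverse (J₁ J₂ : Hyperplane X) : Prop :=
  ∃ a b c d : V, IsSquare X a b c d ∧ s(a, b) ∈ J₁.edges ∧ s(a, d) ∈ J₂.edges

/-- Two distinct hyperplanes are tangent if they are not transverse but their carriers meet. -/
def Tangent (J₁ J₂ : Hyperplane X) : Prop :=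
  J₁ ≠ J₂ ∧ ¬ Transverse J₁ J₂ ∧ (J₁.carrier ∩ J₂.carrier).Nonempty

lemma Transverse.symm {J₁ J₂ : Hyperplane X} (h : Transverse J₁ J₂) : Transverse J₂ J₁ := by
  obtain ⟨a, b, c, d, hs, h₁, h₂⟩ := h
  exact ⟨a, d, c, b, ⟨hs.da.symm, hs.cd.symm, hs.bc.symm, hs.ab.symm, hs.ne_ac, hs.ne_bd.symm,
    hs.not_ac, fun h => hs.not_bd h.symm⟩, h₂, h₁⟩

/-- The graph `X \\ J`, obtained by removing the interiors of the edges of `J`. -/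
def compl (J : Hyperplane X) : SimpleGraph V := X.deleteEdges J.edges

/-- The sectors delimited by `J`: the connected components of `X \\ J`. -/
def Sector (J : Hyperplane X) : Type _ := J.compl.ConnectedComponent

end Hyperplane

lemma EdgeRel.map {X : SimpleGraph V} (f : X ≃g X) {e e' : X.edgeSet} (h : EdgeRel X e e') :
    EdgeRel X (f.mapEdgeSet e) (f.mapEdgeSet e') := by
  rcases h with ⟨a, b, c, hab, hbc, hac, he, he'⟩ | ⟨a, b, c, d, hs, he, he'⟩
  · refine Or.inl ⟨f a, f b, f c, f.map_adj_iff.2 hab, f.map_adj_iff.2 hbc,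
      f.map_adj_iff.2 hac, ?_, ?_⟩
    · change Sym2.map f e = _
      rw [he, Sym2.map_mk]
    · change Sym2.map f e' = _
      rw [he', Sym2.map_mk]
  · refine Or.inr ⟨f a, f b, f c, f d, ⟨f.map_adj_iff.2 hs.ab, f.map_adj_iff.2 hs.bc,
      f.map_adj_iff.2 hs.cd, f.map_adj_iff.2 hs.da, f.injective.ne hs.ne_ac,
      f.injective.ne hs.ne_bd, fun h => hs.not_ac (f.map_adj_iff.1 h),
      fun h => hs.not_bd (f.map_adj_iff.1 h)⟩, ?_, ?_⟩
    · change Sym2.map f e = _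
      rw [he, Sym2.map_mk]
    · change Sym2.map f e' = _
      rw [he', Sym2.map_mk]

/-- Automorphisms of `X` act on the set of hyperplanes, through their action on edges. -/
instance hyperplaneAction (X : SimpleGraph V) : MulAction (X ≃g X) (Hyperplane X) where
  smul f := Quot.map f.mapEdgeSet (fun _ _ h => EdgeRel.map f h)
  one_smul J := by
    induction J using Quot.ind with
    | mk e =>
      refine congrArg (Quot.mk _) (Subtype.ext ?_)
      exact congrFun Sym2.map_id e.1
  mul_smul f g J := by
    induction J using Quot.ind with
    | mk e =>
      refine congrArg (Quot.mk _) (Subtype.ext ?_)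
      exact (Sym2.map_map (g := f) (f := g) e.1).symm

variable {X : SimpleGraph V}

lemma map_mem_edges (f : X ≃g X) {J : Hyperplane X} {e : Sym2 V} (h : e ∈ J.edges) :
    Sym2.map f e ∈ (f • J).edges := by
  obtain ⟨he, rfl⟩ := h
  exact ⟨(f.mapEdgeSet ⟨e, he⟩).2, rfl⟩

lemma map_mem_edges_iff (f : X ≃g X) {J : Hyperplane X} {e : Sym2 V} :
    Sym2.map f e ∈ (f • J).edges ↔ e ∈ J.edges := by
  refine ⟨fun h => ?_, map_mem_edges f⟩
  have h' := map_mem_edges f⁻¹ h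
  rw [inv_smul_smul, Sym2.map_map] at h'
  have hid : (⇑(f⁻¹) ∘ ⇑f : V → V) = id := funext fun v => f.symm_apply_apply v
  rwa [hid, Sym2.map_id, id] at h'

/-- An automorphism stabilising `J` restricts to an automorphism of `X \\ J`. -/
def complIso (J : Hyperplane X) (f : X ≃g X) (hf : f • J = J) : J.compl ≃g J.compl where
  toEquiv := f.toEquiv
  map_rel_iff' := by
    intro a b
    have key : s(f a, f b) ∈ J.edges ↔ s(a, b) ∈ J.edges := by
      have := map_mem_edges_iff f (J := J) (e := s(a, b))
      rwa [hf, Sym2.map_mk] at this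
    change (X.deleteEdges J.edges).Adj (f a) (f b) ↔ (X.deleteEdges J.edges).Adj a b
    rw [SimpleGraph.deleteEdges_adj, SimpleGraph.deleteEdges_adj, key, f.map_adj_iff]

/-! ### Group actions -/

variable {G : Type*} [Group G]

/-- The stabiliser of a hyperplane, for an action `ρ` of `G` by automorphisms on `X`. -/
def hyperplaneStab (ρ : G →* (X ≃g X)) (J : Hyperplane X) : Subgroup G :=
  (MulAction.stabilizer (X ≃g X) J).comap ρ

/-- The permutation action of `stab(J)` on the set of sectors delimited by `J`. -/
def sectorHom (ρ : G →* (X ≃g X)) (J : Hyperplane X) :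
    hyperplaneStab ρ J →* Equiv.Perm J.Sector where
  toFun g := (complIso J (ρ g) g.2).connectedComponentEquiv
  map_one' := by
    refine Equiv.ext fun S => ?_
    induction S using SimpleGraph.ConnectedComponent.ind with
    | h v =>
      refine congrArg J.compl.connectedComponentMk ?_
      change (ρ (1 : G)) v = v
      rw [map_one]; rfl
  map_mul' g h := by
    refine Equiv.ext fun S => ?_
    induction S using SimpleGraph.ConnectedComponent.ind with
    | h v =>
      refine congrArg J.compl.connectedComponentMk ?_
      change (ρ ((g : G) * (h : G))) v = ρ g (ρ h v)
      rw [map_mul]; rfl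

/-- The group `𝔖(J)`: the image of `stab(J)` in the permutation group of the set of sectors. -/
def sectorGroup (ρ : G →* (X ≃g X)) (J : Hyperplane X) : Subgroup (Equiv.Perm J.Sector) :=
  (sectorHom ρ J).range

/-- The set of orbits of `𝔖(J)` on the set of sectors delimited by `J`. -/
abbrev SectorOrbits (ρ : G →* (X ≃g X)) (J : Hyperplane X) : Type _ :=
  MulAction.orbitRel.Quotient (sectorGroup ρ J) J.Sector

/-- Special actions: faithful, hyperplane-special, and such that `𝔖(J)` acts freely on the set of
sectors delimited by `J`, for every hyperplane `J`. -/
structure IsSpecial (ρ : G →* (X ≃g X)) : Prop where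
  faithful : Function.Injective ρ
  not_transverse : ∀ (J : Hyperplane X) (g : G), ¬ J.Transverse (ρ g • J)
  not_tangent : ∀ (J : Hyperplane X) (g : G), ¬ J.Tangent (ρ g • J)
  not_inter_osculate : ∀ (J₁ J₂ : Hyperplane X) (g : G),
    J₁.Transverse J₂ → ¬ J₁.Tangent (ρ g • J₂)
  free : ∀ (J : Hyperplane X), ∀ σ ∈ sectorGroup ρ J, ∀ S : J.Sector, σ S = S → σ = 1

/-- `J` is a system of representatives of the hyperplanes of `X` modulo the action of `G`. -/
def IsRepresentatives {I : Type*} (ρ : G →* (X ≃g X)) (J : I → Hyperplane X) : Prop :=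
  ∀ H : Hyperplane X, ∃! i : I, ∃ g : G, H = ρ g • J i

/-- The graph on the representatives of hyperplanes, two distinct ones being joined by an edge when
they have transverse `G`-translates. -/
def crossingGraph {I : Type*} (ρ : G →* (X ≃g X)) (J : I → Hyperplane X) : SimpleGraph I where
  Adj i j := i ≠ j ∧ ∃ g h : G, (ρ g • J i).Transverse (ρ h • J j)
  symm := ⟨fun _ _ ⟨hne, g, h, ht⟩ => ⟨hne.symm, h, g, ht.symm⟩⟩
  loopless := ⟨fun _ h => h.1 rfl⟩

end Graphs

/-! ### Graph products -/

section GraphProducts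

variable {I : Type*}

/-- The commutators `[g, h]` with `g ∈ G_u`, `h ∈ G_v` and `u, v` adjacent in `Γ`. -/
def graphProductRels (Γ : SimpleGraph I) (𝒢 : I → Type*) [∀ i, Group (𝒢 i)] :
    Set (Monoid.CoprodI 𝒢) :=
  {x | ∃ u v : I, Γ.Adj u v ∧ ∃ (g : 𝒢 u) (h : 𝒢 v),
    x = Monoid.CoprodI.of g * Monoid.CoprodI.of h *
      (Monoid.CoprodI.of g)⁻¹ * (Monoid.CoprodI.of h)⁻¹}

/-- The graph product `Γ𝒢`. -/
abbrev GraphProduct (Γ : SimpleGraph I) (𝒢 : I → Type*) [∀ i, Group (𝒢 i)] : Type _ :=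
  Monoid.CoprodI 𝒢 ⧸ Subgroup.normalClosure (graphProductRels Γ 𝒢)

/-- The canonical map from a vertex-group to the graph product. -/
def GraphProduct.of (Γ : SimpleGraph I) (𝒢 : I → Type*) [∀ i, Group (𝒢 i)] (u : I) :
    𝒢 u →* GraphProduct Γ 𝒢 :=
  (QuotientGroup.mk' _).comp Monoid.CoprodI.of

/-- The graph `QM(Γ, 𝒢)`: the Cayley graph of `Γ𝒢` with respect to the union of the
`G_u \ {1}`. -/
def graphProductQM (Γ : SimpleGraph I) (𝒢 : I → Type*) [∀ i, Group (𝒢 i)] :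
    SimpleGraph (GraphProduct Γ 𝒢) :=
  SimpleGraph.mulCayley (⋃ u : I, GraphProduct.of Γ 𝒢 u '' {g | g ≠ 1})

end GraphProducts

end QuasiMedian

open QuasiMedian

/-! Identify the sectors of `J i` with the vertex-group `sectorGroup ρ (J i) × K i`, equivariantly
for left multiplication by the first factor; freeness makes this possible. An oriented edge dual to
a translate of `J i` then receives as label the element a⁻¹b, where a and b are the elements
attached to the sectors of its endpoints after translating back to `J i`. This label does not depend
on the translating element and is invariant under `G`. Labels multiply along triangles, and around a
square they commute, its two hyperplanes having adjacent types. Since triangles and squares fill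
every cycle of a quasi-median graph (`exists_potential`), the labels integrate to a map Φ into the
graph product, and their invariance gives equivariance.

Isometry and gatedness come together from `len_eq_and_exists`. Given h, let x minimise the distance
from Φ x to h. By induction on d(x, y), the distance from Φ y to h is d(x, y) plus the minimum:
walking away from x always prepends a new syllable. A syllable that merged with an existing head
would contradict one of the conditions of specialness: edges of the same type at a vertex lie in one
hyperplane (no self-tangency), and edges of adjacent types at a vertex span a square (no
inter-osculation). At x itself no head can be the type of an edge, because every nontrivial label
occurs on some edge at x; this is where the exact cardinality of `K i` matters. Taking h in the
image gives the isometry, and arbitrary h gives gates.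

Two inputs carry the argument. In a quasi-median graph, each hyperplane is described by
nearest-point projection to any clique dual to it (`edgeHyp_eq_iff`, `reachable_compl_iff`), and
transverse hyperplanes span a square wherever their edges meet (`exists_square`). In a graph
product, reduced words are unique up to shuffling, so word length and first syllables can be read
off them. -/

namespace QuasiMedian

/-! ### Distances to triangles and squares in a quasi-median graph. -/

section Geometry

variable {V : Type*} {X : SimpleGraph V}

lemma IsSquare.rotate {a b c d : V} (h : IsSquare X a b c d) : IsSquare X b c d a :=
  ⟨h.bc, h.cd, h.da, h.ab, h.ne_bd, h.ne_ac.symm, h.not_bd, fun e => h.not_ac e.symm⟩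

lemma IsSquare.reflect {a b c d : V} (h : IsSquare X a b c d) : IsSquare X a d c b :=
  ⟨h.da.symm, h.cd.symm, h.bc.symm, h.ab.symm, h.ne_ac, h.ne_bd.symm, h.not_ac,
    fun e => h.not_bd e.symm⟩

/-- The square `a b c d` read from `b`, in the opposite direction. -/
lemma IsSquare.swap {a b c d : V} (h : IsSquare X a b c d) : IsSquare X b a d c :=
  h.rotate.reflect

namespace IsQuasiMedian

variable (hX : IsQuasiMedian X)

include hX

lemma adj_of_common {x y a b : V} (hxy : X.Adj x y) (hax : X.Adj a x) (hay : X.Adj a y)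
    (hbx : X.Adj b x) (hby : X.Adj b y) (hab : a ≠ b) : X.Adj a b := by
  by_contra h
  have h' : ¬ X.Adj b a := fun k => h k.symm
  refine hX.no_K4Minus ⟨⟨⟨![a, b, x, y], ?_⟩, ?_⟩⟩
  · intro i j hij
    fin_cases i <;> fin_cases j <;>
      simp_all [hxy.ne, hxy.ne.symm, hax.ne, hax.ne.symm, hay.ne, hay.ne.symm, hbx.ne,
        hbx.ne.symm, hby.ne, hby.ne.symm, hab.symm]
  · intro i j
    change X.Adj (![a, b, x, y] i) (![a, b, x, y] j) ↔ _
    fin_cases i <;> fin_cases j <;>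
      simp [K4Minus, h, hxy, hxy.symm, hax, hax.symm, hay, hay.symm, hbx, hbx.symm, hby, hby.symm,
        h']

lemma not_K32 {u v p q r : V} (huv : u ≠ v) (nuv : ¬ X.Adj u v) (hpq : p ≠ q) (hpr : p ≠ r)
    (hqr : q ≠ r) (npq : ¬ X.Adj p q) (npr : ¬ X.Adj p r) (nqr : ¬ X.Adj q r)
    (hpu : X.Adj p u) (hpv : X.Adj p v) (hqu : X.Adj q u) (hqv : X.Adj q v)
    (hru : X.Adj r u) (hrv : X.Adj r v) : False := by
  have n1 : ¬ X.Adj v u := fun k => nuv k.symm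
  have n2 : ¬ X.Adj q p := fun k => npq k.symm
  have n3 : ¬ X.Adj r p := fun k => npr k.symm
  have n4 : ¬ X.Adj r q := fun k => nqr k.symm
  refine hX.no_K32 ⟨⟨⟨Sum.elim ![p, q, r] ![u, v], ?_⟩, ?_⟩⟩
  · rintro (i | i) (j | j) hij <;> fin_cases i <;> fin_cases j <;>
      simp_all [hpu.ne, hpu.ne.symm, hpv.ne, hpv.ne.symm, hqu.ne, hqu.ne.symm, hqv.ne,
        hqv.ne.symm, hru.ne, hru.ne.symm, hrv.ne, hrv.ne.symm, huv.symm, hpq.symm, hpr.symm,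
        hqr.symm]
  · intro i j
    change X.Adj (Sum.elim ![p, q, r] ![u, v] i) (Sum.elim ![p, q, r] ![u, v] j) ↔ _
    rcases i with (i | i) <;> rcases j with (j | j) <;> fin_cases i <;> fin_cases j <;>
      simp [nuv, npq, npr, nqr, hpu, hpu.symm, hpv, hpv.symm, hqu, hqu.symm, hqv, hqv.symm,
        hru, hru.symm, hrv, hrv.symm, n1, n2, n3, n4]

lemma dist_le_succ (a : V) {x y : V} (h : X.Adj x y) : X.dist a y ≤ X.dist a x + 1 := by
  have := hX.connected.dist_triangle (u := a) (v := x) (w := y)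
  rwa [SimpleGraph.dist_eq_one_iff_adj.2 h] at this

lemma not_adj_of_dist {a x y : V} (h : X.dist a x + 2 ≤ X.dist a y) : ¬ X.Adj x y := fun e => by
  have := hX.dist_le_succ a e
  omega

lemma exists_closer {a x : V} (h : a ≠ x) : ∃ y, X.Adj x y ∧ X.dist a y + 1 = X.dist a x := by
  obtain ⟨p, hp⟩ := hX.connected.exists_walk_length_eq_dist x a
  cases p with
  | nil => exact absurd rfl h
  | cons e q =>
    refine ⟨_, e, ?_⟩
    have h1 := SimpleGraph.dist_le q
    have h2 := hX.dist_le_succ a e.symm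
    rw [SimpleGraph.Walk.length_cons] at hp
    rw [SimpleGraph.dist_comm] at h1 hp
    omega

lemma dist_eq_two {x y z : V} (hxy : X.Adj x y) (hyz : X.Adj y z) (hxz : x ≠ z)
    (nxz : ¬ X.Adj x z) : X.dist x z = 2 := by
  have h1 := hX.connected.one_lt_dist_of_ne_of_not_adj hxz nxz
  have h2 := hX.dist_le_succ x hyz
  rw [SimpleGraph.dist_eq_one_iff_adj.2 hxy] at h2
  omega

/-- The nearer common neighbour of a and b given by the triangle condition must be adjacent to c, so
c cannot be farther. -/
lemma triangle_dist (p : V) {a b c : V} (hab : X.Adj a b) (hbc : X.Adj b c) (hac : X.Adj a c)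
    (h : X.dist p a = X.dist p b) : X.dist p c ≤ X.dist p a := by
  by_contra hlt
  obtain ⟨z, hza, hzb, hz⟩ := hX.triangle p a b hab h
  refine hX.not_adj_of_dist (a := p) (x := z) (y := c) (by omega) ?_
  exact hX.adj_of_common hab hza hzb hac.symm hbc.symm (by rintro rfl; omega)

/-- A triangle and a square sharing an edge extend to a prism. -/
lemma prism {a b c d z : V} (h : IsSquare X a b c d) (hza : X.Adj z a) (hzb : X.Adj z b) :
    ∃ e, IsSquare X a z e d ∧ IsSquare X b z e c := by
  have hzd : z ≠ d := by rintro rfl; exact h.not_bd hzb.symm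
  have hzc : z ≠ c := by rintro rfl; exact h.not_ac hza.symm
  have nzd : ¬ X.Adj z d := fun e =>
    h.not_bd (hX.adj_of_common hza hzb.symm h.ab.symm e.symm h.da h.ne_bd)
  have nzc : ¬ X.Adj z c := fun e =>
    h.not_ac (hX.adj_of_common hzb hza.symm h.ab e.symm h.bc.symm h.ne_ac)
  have d1 := hX.dist_eq_two hza h.da.symm hzd nzd
  have d2 := hX.dist_eq_two hzb h.bc hzc nzc
  obtain ⟨e, hec, hed, he⟩ := hX.triangle z c d h.cd (by omega)
  have hze : X.Adj z e := SimpleGraph.dist_eq_one_iff_adj.1 (by omega)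
  have hea : a ≠ e := by rintro rfl; exact h.not_ac hec
  have heb : b ≠ e := by rintro rfl; exact h.not_bd hed
  refine ⟨e, ⟨hza.symm, hze, hed, h.da, hea, hzd, fun k => ?_, nzd⟩,
    ⟨hzb.symm, hze, hec, h.bc.symm, heb, hzc, fun k => ?_, nzc⟩⟩
  · exact h.not_ac (hX.adj_of_common hed k h.da.symm hec.symm h.cd h.ne_ac)
  · exact h.not_bd (hX.adj_of_common hec k h.bc hed.symm h.cd.symm h.ne_bd)

/-- In a square, a vertex cannot see two opposite vertices at distance `k + 1` and the two others at
distance `k`. -/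
lemma square_dist_aux (p : V) {a b c d : V} (h : IsSquare X a b c d)
    (hb : X.dist p b = X.dist p a + 1) (hc : X.dist p c = X.dist p a) :
    X.dist p d + 1 = X.dist p a := by
  by_contra hne
  obtain ⟨w, hwa, hwc, hw⟩ := hX.quadrangle p a c b h.ne_ac h.ab.symm h.bc (by omega) (by omega)
  have nwb : ¬ X.Adj w b := hX.not_adj_of_dist (a := p) (by omega)
  have hwd : w ≠ d := by rintro rfl; omega
  -- Otherwise b, d and w would be three pairwise non-adjacent common neighbours of a and c.
  refine hX.not_K32 h.ne_ac h.not_ac (p := b) (q := d) (r := w) h.ne_bd (by rintro rfl; omega)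
    hwd.symm h.not_bd (fun k => nwb k.symm) (fun k => h.not_ac ?_) h.ab.symm h.bc h.da h.cd.symm
    hwa hwc
  exact hX.adj_of_common k h.da.symm hwa.symm h.cd hwc.symm h.ne_ac

lemma square_dist_far (p : V) {a b c d : V} (h : IsSquare X a b c d)
    (hb : X.dist p b = X.dist p a + 1) (hd : X.dist p d = X.dist p a + 1) :
    X.dist p c = X.dist p a + 2 := by
  by_contra hne
  have h1 := hX.dist_le_succ p h.bc
  have h2 := hX.dist_le_succ p h.bc.symm
  by_cases hc : X.dist p c = X.dist p a
  · have := hX.square_dist_aux p h hb hc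
    omega
  -- In the remaining case b and c are equidistant from p. The nearer vertex z yields a prism, whose
  -- face through a, b, z puts e one step closer than a, two steps from the level of its neighbour
  -- d.
  obtain ⟨z, hzb, hzc, hz⟩ := hX.triangle p b c h.bc (by omega)
  obtain ⟨e, s1, s2⟩ := hX.prism h.rotate hzb hzc
  have hzd : ¬ X.dist p e = X.dist p a := by
    intro he
    have := hX.triangle_dist p (a := a) (b := e) (c := d) s1.cd.symm s2.cd h.da.symm he.symm
    omega
  have := hX.square_dist_aux p (a := a) (b := b) (c := z) (d := e) s1.rotate.rotate.rotate hb
    (by omega)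
  have e1 := hX.dist_le_succ p s1.cd
  have e2 := hX.dist_le_succ p s1.cd.symm
  have e3 := hX.dist_le_succ p s2.cd
  omega

/-- Parallel sides of a square point the same way as seen from p; this is what makes gates
compatible with hyperplanes. -/
lemma square_dist (p : V) {a b c d : V} (h : IsSquare X a b c d)
    (hb : X.dist p b = X.dist p a + 1) : X.dist p c = X.dist p d + 1 := by
  have h1 := hX.dist_le_succ p h.da
  have h2 := hX.dist_le_succ p h.da.symm
  have h3 := hX.dist_le_succ p h.bc
  have h4 := hX.dist_le_succ p h.bc.symm
  have h5 := hX.dist_le_succ p h.cd.symm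
  rcases Nat.lt_trichotomy (X.dist p d) (X.dist p a) with hd | hd | hd
  · omega
  · by_contra hne
    have := hX.dist_le_succ p h.cd
    have := hX.square_dist_aux p h hb (by omega)
    omega
  · have := hX.square_dist_far p h hb (by omega)
    omega

end IsQuasiMedian
end Geometry
end QuasiMedian

namespace QuasiMedian

/-! ### Projections to cliques, sectors, and squares spanned by transverse hyperplanes. -/

section Gates

variable {V : Type*} {X : SimpleGraph V}

/-- The hyperplane dual to an edge. -/
def edgeHyp {x y : V} (h : X.Adj x y) : Hyperplane X := Quot.mk (EdgeRel X) ⟨s(x, y), h⟩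

lemma edgeHyp_congr {x y x' y' : V} (h : X.Adj x y) (h' : X.Adj x' y')
    (e : s(x, y) = s(x', y')) : edgeHyp h = edgeHyp h' :=
  congrArg (Quot.mk (EdgeRel X)) (Subtype.ext e)

lemma edgeHyp_symm {x y : V} (h : X.Adj x y) : edgeHyp h.symm = edgeHyp h :=
  edgeHyp_congr _ _ Sym2.eq_swap

lemma edgeHyp_triangle {x y z : V} (hxy : X.Adj x y) (hyz : X.Adj y z) (hxz : X.Adj x z) :
    edgeHyp hxy = edgeHyp hxz :=
  Quot.sound (Or.inl ⟨x, y, z, hxy, hyz, hxz, rfl, rfl⟩)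

lemma edgeHyp_square {a b c d : V} (h : IsSquare X a b c d) :
    edgeHyp h.ab = edgeHyp h.cd.symm :=
  Quot.sound (Or.inr ⟨a, b, c, d, h, rfl, rfl⟩)

lemma edgeHyp_square' {a b c d : V} (h : IsSquare X a b c d) :
    edgeHyp h.da.symm = edgeHyp h.bc :=
  edgeHyp_square h.reflect

lemma mem_edges_iff {J : Hyperplane X} {a b : V} :
    s(a, b) ∈ J.edges ↔ ∃ h : X.Adj a b, edgeHyp h = J := Iff.rfl

/-- The maximal clique containing the edge `x y`. -/
def edgeClique (X : SimpleGraph V) (x y : V) : Set V :=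
  {z | z = x ∨ z = y ∨ (X.Adj z x ∧ X.Adj z y)}

lemma left_mem_edgeClique (x y : V) : x ∈ edgeClique X x y := Or.inl rfl

lemma right_mem_edgeClique (x y : V) : y ∈ edgeClique X x y := Or.inr (Or.inl rfl)

open Classical in
/-- The vertex of the clique containing `x y` which is nearest to `v`. -/
noncomputable def cliqueGate (X : SimpleGraph V) (x y v : V) : V :=
  -- The default value v is never taken when x and y are adjacent, by `cliqueGate_spec`.
  if h : ∃ p ∈ edgeClique X x y, ∀ z ∈ edgeClique X x y, z ≠ p → X.dist z v = X.dist p v + 1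
  then h.choose else v

namespace IsQuasiMedian

lemma edgeClique_adj (hX : IsQuasiMedian X) {x y p q : V} (hxy : X.Adj x y)
    (hp : p ∈ edgeClique X x y) (hq : q ∈ edgeClique X x y) (hpq : p ≠ q) : X.Adj p q := by
  rcases hp with rfl | rfl | ⟨h1, h2⟩ <;> rcases hq with rfl | rfl | ⟨h3, h4⟩
  · exact absurd rfl hpq
  · exact hxy
  · exact h3.symm
  · exact hxy.symm
  · exact absurd rfl hpq
  · exact h4.symm
  · exact h1
  · exact h2
  · exact hX.adj_of_common hxy h1 h2 h3 h4 hpq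

lemma mem_edgeClique_of_adj (hX : IsQuasiMedian X) {x y p q z : V} (hxy : X.Adj x y)
    (hp : p ∈ edgeClique X x y) (hq : q ∈ edgeClique X x y) (hpq : p ≠ q)
    (hzp : X.Adj z p) (hzq : X.Adj z q) : z ∈ edgeClique X x y := by
  have key : ∀ t ∈ edgeClique X x y, z ≠ t → X.Adj z t := by
    intro t ht hzt
    by_cases h1 : t = p
    · rwa [h1]
    by_cases h2 : t = q
    · rwa [h2]
    exact hX.adj_of_common (hX.edgeClique_adj hxy hp hq hpq) hzp hzq
      (hX.edgeClique_adj hxy ht hp h1) (hX.edgeClique_adj hxy ht hq h2) hzt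
  by_cases h1 : z = x
  · exact Or.inl h1
  by_cases h2 : z = y
  · exact Or.inr (Or.inl h2)
  exact Or.inr (Or.inr ⟨key x (left_mem_edgeClique x y) h1, key y (right_mem_edgeClique x y) h2⟩)

lemma edgeHyp_clique (hX : IsQuasiMedian X) {x y p q : V} (hxy : X.Adj x y)
    (hp : p ∈ edgeClique X x y) (hq : q ∈ edgeClique X x y) (hpq : X.Adj p q) :
    edgeHyp hpq = edgeHyp hxy := by
  have key : ∀ t ∈ edgeClique X x y, ∀ h : X.Adj x t, edgeHyp h = edgeHyp hxy := by
    rintro t (rfl | rfl | ⟨h1, h2⟩) h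
    · exact absurd h X.irrefl
    · rfl
    · exact edgeHyp_triangle h h2 hxy
  by_cases h1 : p = x
  · subst h1; exact key q hq hpq
  by_cases h2 : q = x
  · subst h2; rw [← edgeHyp_symm]; exact key p hp hpq.symm
  have hpx := hX.edgeClique_adj hxy hp (left_mem_edgeClique x y) h1
  have hqx := hX.edgeClique_adj hxy hq (left_mem_edgeClique x y) h2
  rw [edgeHyp_triangle hpq hqx hpx, ← edgeHyp_symm]
  exact key p hp hpx.symm

section

variable (hX : IsQuasiMedian X) {x y : V} (hxy : X.Adj x y)

include hX hxy

lemma cliqueGate_spec (v : V) : cliqueGate X x y v ∈ edgeClique X x y ∧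
    ∀ z ∈ edgeClique X x y, z ≠ cliqueGate X x y v →
      X.dist z v = X.dist (cliqueGate X x y v) v + 1 := by
  have h : ∃ p ∈ edgeClique X x y, ∀ z ∈ edgeClique X x y, z ≠ p →
      X.dist z v = X.dist p v + 1 := by
    obtain ⟨p, hp, hmin⟩ := (measure fun z => X.dist z v).wf.has_min (edgeClique X x y)
      ⟨x, left_mem_edgeClique x y⟩
    refine ⟨p, hp, fun z hz hzp => ?_⟩
    have hadj := hX.edgeClique_adj hxy hz hp hzp
    have h1 : ¬ X.dist z v < X.dist p v := hmin z hz
    have h2 := hX.dist_le_succ v hadj.symm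
    rw [SimpleGraph.dist_comm (u := v), SimpleGraph.dist_comm (u := v)] at h2
    by_contra hne
    -- A tie would produce a nearer common neighbour of z and p, which again lies in the maximal
    -- clique.
    obtain ⟨w, hwz, hwp, hw⟩ := hX.triangle v z p hadj (by
      rw [SimpleGraph.dist_comm (u := v), SimpleGraph.dist_comm (u := v)]; omega)
    rw [SimpleGraph.dist_comm (u := v), SimpleGraph.dist_comm (u := v)] at hw
    have h3 : ¬ X.dist w v < X.dist p v :=
      hmin w (hX.mem_edgeClique_of_adj hxy hz hp hzp hwz hwp)
    omega
  unfold cliqueGate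
  rw [dif_pos h]
  exact h.choose_spec

lemma cliqueGate_mem (v : V) : cliqueGate X x y v ∈ edgeClique X x y :=
  (hX.cliqueGate_spec hxy v).1

lemma dist_of_ne_cliqueGate {v z : V} (hz : z ∈ edgeClique X x y) (h : z ≠ cliqueGate X x y v) :
    X.dist z v = X.dist (cliqueGate X x y v) v + 1 :=
  (hX.cliqueGate_spec hxy v).2 z hz h

lemma cliqueGate_of_mem {v : V} (hv : v ∈ edgeClique X x y) : cliqueGate X x y v = v := by
  by_contra h
  have := hX.dist_of_ne_cliqueGate hxy hv (Ne.symm h)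
  rw [SimpleGraph.dist_self] at this
  omega

lemma cliqueGate_eq_of_closer {v v' : V} (h : X.Adj v v')
    (hd : X.dist (cliqueGate X x y v) v' + 1 = X.dist (cliqueGate X x y v) v) :
    cliqueGate X x y v' = cliqueGate X x y v := by
  by_contra hne
  have h1 := hX.dist_of_ne_cliqueGate hxy (cliqueGate_mem hX hxy v) (Ne.symm hne)
  have h2 := hX.dist_of_ne_cliqueGate hxy (cliqueGate_mem hX hxy v') hne
  have h3 := hX.dist_le_succ (cliqueGate X x y v') h.symm
  omega

lemma dist_cliqueGate_eq {a b : V} (h : X.Adj a b)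
    (hne : cliqueGate X x y a ≠ cliqueGate X x y b) :
    X.dist (cliqueGate X x y b) b = X.dist (cliqueGate X x y a) a := by
  have h1 := hX.dist_of_ne_cliqueGate hxy (cliqueGate_mem hX hxy a) hne
  have h2 := hX.dist_of_ne_cliqueGate hxy (cliqueGate_mem hX hxy b) hne.symm
  have h3 := hX.dist_le_succ (cliqueGate X x y a) h
  have h4 := hX.dist_le_succ (cliqueGate X x y b) h.symm
  omega

/-- One rung of the ladder joining an edge to the clique: the quadrangle condition is applied from
the gate of b, for which a' and b are both one step closer than a. Iterating it shows that the edge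
is parallel to an edge of the clique. -/
lemma exists_ladder {a b a' : V} (h : X.Adj a b)
    (hne : cliqueGate X x y a ≠ cliqueGate X x y b) (ha' : X.Adj a a')
    (hd : X.dist (cliqueGate X x y a) a' + 1 = X.dist (cliqueGate X x y a) a) :
    ∃ w, IsSquare X a a' w b ∧ cliqueGate X x y w = cliqueGate X x y b := by
  have h0 := hX.cliqueGate_eq_of_closer hxy ha' hd
  have h1 := hX.dist_cliqueGate_eq hxy h hne
  have h2 := hX.dist_of_ne_cliqueGate hxy (cliqueGate_mem hX hxy b) hne.symm
  have h3 := hX.dist_of_ne_cliqueGate hxy (v := a') (cliqueGate_mem hX hxy b)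
    (by rw [h0]; exact hne.symm)
  have h4 := hX.dist_of_ne_cliqueGate hxy (cliqueGate_mem hX hxy a) hne
  rw [h0] at h3
  have hab : a' ≠ b := by rintro rfl; omega
  obtain ⟨w, hwa, hwb, hw⟩ := hX.quadrangle (cliqueGate X x y b) a' b a hab ha' h
    (by omega) (by omega)
  have hwa' : a ≠ w := by rintro rfl; omega
  refine ⟨w, ⟨ha', hwa.symm, hwb, h.symm, hwa', hab, fun k => ?_, fun k => ?_⟩, ?_⟩
  · exact hX.not_adj_of_dist (a := cliqueGate X x y b) (by omega) k.symm
  · exact hX.not_adj_of_dist (a := cliqueGate X x y a) (by omega) k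
  · exact hX.cliqueGate_eq_of_closer hxy hwb.symm (by omega)

lemma edgeHyp_eq_of_cliqueGate_ne : ∀ (n : ℕ) {a b : V} (h : X.Adj a b),
    X.dist (cliqueGate X x y a) a = n → cliqueGate X x y a ≠ cliqueGate X x y b →
      edgeHyp h = edgeHyp hxy := by
  intro n
  induction n with
  | zero =>
    intro a b h hn hne
    have h1 := hX.dist_cliqueGate_eq hxy h hne
    rw [hn, hX.connected.dist_eq_zero_iff] at h1
    rw [hX.connected.dist_eq_zero_iff] at hn
    refine hX.edgeHyp_clique hxy ?_ ?_ h
    · rw [← hn]; exact hX.cliqueGate_mem hxy a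
    · rw [← h1]; exact hX.cliqueGate_mem hxy b
  | succ n ih =>
    intro a b h hn hne
    obtain ⟨a', ha', hd⟩ := hX.exists_closer (a := cliqueGate X x y a) (x := a) (by
      intro he; rw [he, SimpleGraph.dist_self] at hn; omega)
    obtain ⟨w, hs, hw⟩ := hX.exists_ladder hxy h hne ha' hd
    have h0 := hX.cliqueGate_eq_of_closer hxy ha' hd
    rw [← ih hs.bc (by rw [h0]; omega) (by rw [h0, hw]; exact hne)]
    exact edgeHyp_square' hs

lemma cliqueGate_ne_triangle {a b c : V} (hab : X.Adj a b) (hbc : X.Adj b c) (hac : X.Adj a c)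
    (hne : cliqueGate X x y a ≠ cliqueGate X x y b) :
    cliqueGate X x y a ≠ cliqueGate X x y c := by
  intro he
  have h1 := hX.dist_cliqueGate_eq hxy hab hne
  have h2 := hX.dist_cliqueGate_eq hxy hbc (by rw [← he]; exact hne.symm)
  have h3 := hX.dist_of_ne_cliqueGate hxy (v := b) (cliqueGate_mem hX hxy a) hne
  rw [← he] at h2
  have := hX.triangle_dist (cliqueGate X x y a) hac hbc.symm hab (by omega)
  omega

/-- If c and d had a common gate, the difference of their distances to a vertex of the clique would
not depend on that vertex. By `square_dist` it has opposite signs at the gates of a and b. -/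
lemma cliqueGate_ne_square {a b c d : V} (h : IsSquare X a b c d)
    (hne : cliqueGate X x y a ≠ cliqueGate X x y b) :
    cliqueGate X x y d ≠ cliqueGate X x y c := by
  intro he
  have h1 := hX.dist_cliqueGate_eq hxy h.ab hne
  have h2 := hX.dist_of_ne_cliqueGate hxy (v := b) (cliqueGate_mem hX hxy a) hne
  have h3 := hX.dist_of_ne_cliqueGate hxy (v := a) (cliqueGate_mem hX hxy b) hne.symm
  have h4 := hX.square_dist (cliqueGate X x y a) h (by omega)
  have h5 := hX.square_dist (cliqueGate X x y b) h.swap (by omega)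
  by_cases k1 : cliqueGate X x y a = cliqueGate X x y d
  · have := hX.dist_of_ne_cliqueGate hxy (v := d) (cliqueGate_mem hX hxy b) (k1 ▸ hne.symm)
    have := hX.dist_of_ne_cliqueGate hxy (v := c) (cliqueGate_mem hX hxy b)
      (by rw [← he, ← k1]; exact hne.symm)
    have : X.dist (cliqueGate X x y d) d = X.dist (cliqueGate X x y a) d := by rw [k1]
    have : X.dist (cliqueGate X x y c) c = X.dist (cliqueGate X x y a) c := by rw [k1, he]
    omega
  · have := hX.dist_of_ne_cliqueGate hxy (v := d) (cliqueGate_mem hX hxy a) k1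
    have := hX.dist_of_ne_cliqueGate hxy (v := c) (cliqueGate_mem hX hxy a) (he ▸ k1)
    have := hX.dist_cliqueGate_eq hxy h.da.symm k1
    by_cases k2 : cliqueGate X x y b = cliqueGate X x y c
    · have : X.dist (cliqueGate X x y d) d = X.dist (cliqueGate X x y b) d := by rw [k2, he]
      have : X.dist (cliqueGate X x y c) c = X.dist (cliqueGate X x y b) c := by rw [k2]
      omega
    · have := hX.dist_cliqueGate_eq hxy h.bc k2
      omega

/-- An edge is dual to the hyperplane of `x y` exactly when its endpoints have distinct gates in
the clique of `x y`. -/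
lemma edgeHyp_eq_iff {a b : V} (h : X.Adj a b) :
    edgeHyp h = edgeHyp hxy ↔ cliqueGate X x y a ≠ cliqueGate X x y b := by
  refine ⟨fun he => ?_, hX.edgeHyp_eq_of_cliqueGate_ne hxy _ h rfl⟩
  -- Having endpoints with distinct gates is invariant under the generating relation, so it descends
  -- to hyperplanes.
  let Q : Hyperplane X → Prop := Quot.lift
    (fun e => ¬ (Sym2.map (cliqueGate X x y) (e : Sym2 V)).IsDiag) (by
      rintro ⟨e, _⟩ ⟨f, _⟩ (⟨a, b, c, hab, hbc, hac, h1, h2⟩ | ⟨a, b, c, d, hs, h1, h2⟩)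
      · simp only at h1 h2
        subst h1 h2
        simp only [Sym2.map_mk, Sym2.mk_isDiag_iff]
        exact propext ⟨hX.cliqueGate_ne_triangle hxy hab hbc hac,
          hX.cliqueGate_ne_triangle hxy hac hbc.symm hab⟩
      · simp only at h1 h2
        subst h1 h2
        simp only [Sym2.map_mk, Sym2.mk_isDiag_iff]
        exact propext ⟨hX.cliqueGate_ne_square hxy hs,
          hX.cliqueGate_ne_square hxy hs.rotate.rotate.swap⟩)
  have h1 : Q (edgeHyp hxy) := by
    change ¬ (Sym2.map (cliqueGate X x y) s(x, y)).IsDiag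
    rw [Sym2.map_mk, Sym2.mk_isDiag_iff, hX.cliqueGate_of_mem hxy (left_mem_edgeClique x y),
      hX.cliqueGate_of_mem hxy (right_mem_edgeClique x y)]
    exact hxy.ne
  rw [← he] at h1
  change ¬ (Sym2.map (cliqueGate X x y) s(a, b)).IsDiag at h1
  rwa [Sym2.map_mk, Sym2.mk_isDiag_iff] at h1

lemma compl_adj_iff {a b : V} : (edgeHyp hxy).compl.Adj a b ↔
    X.Adj a b ∧ cliqueGate X x y a = cliqueGate X x y b := by
  change (X.deleteEdges _).Adj a b ↔ _
  rw [SimpleGraph.deleteEdges_adj]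
  refine and_congr_right fun h => ?_
  rw [mem_edges_iff, ← not_iff_not, not_not]
  exact ⟨fun ⟨h', e⟩ => (hX.edgeHyp_eq_iff hxy h').1 e,
    fun e => ⟨h, (hX.edgeHyp_eq_iff hxy h).2 e⟩⟩

lemma reachable_cliqueGate : ∀ (n : ℕ) (v : V), X.dist (cliqueGate X x y v) v = n →
    (edgeHyp hxy).compl.Reachable v (cliqueGate X x y v) := by
  intro n
  induction n with
  | zero =>
    intro v hn
    rw [hX.connected.dist_eq_zero_iff] at hn
    rw [hn]
  | succ n ih =>
    intro v hn
    obtain ⟨v', hv', hd⟩ := hX.exists_closer (a := cliqueGate X x y v) (x := v) (by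
      intro he; rw [he, SimpleGraph.dist_self] at hn; omega)
    have h0 := hX.cliqueGate_eq_of_closer hxy hv' hd
    have h1 := ih v' (by rw [h0]; omega)
    rw [h0] at h1
    exact ((hX.compl_adj_iff hxy).2 ⟨hv', h0.symm⟩).reachable.trans h1

/-- Two vertices lie in the same sector exactly when they have the same gate. -/
lemma reachable_compl_iff {a b : V} : (edgeHyp hxy).compl.Reachable a b ↔
    cliqueGate X x y a = cliqueGate X x y b := by
  constructor
  · rintro ⟨p⟩
    induction p with
    | nil => rfl
    | cons h _ ih => exact ((hX.compl_adj_iff hxy).1 h).2.trans ih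
  · intro h
    have h1 := hX.reachable_cliqueGate hxy _ a rfl
    rw [h] at h1
    exact h1.trans (hX.reachable_cliqueGate hxy _ b rfl).symm

end

variable (hX : IsQuasiMedian X)

include hX

/-- The gate of z is at the same distance from z as the gate of y is from y, namely 0; so z lies in
the clique of y and x. -/
lemma eq_or_adj_of_edgeHyp_eq {x y z : V} (hyx : X.Adj y x) (hyz : X.Adj y z)
    (h : edgeHyp hyz = edgeHyp hyx) : x = z ∨ X.Adj x z := by
  have h1 := (hX.edgeHyp_eq_iff hyx hyz).1 h
  have h2 := hX.dist_cliqueGate_eq hyx hyz h1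
  rw [hX.cliqueGate_of_mem hyx (left_mem_edgeClique y x), SimpleGraph.dist_self,
    hX.connected.dist_eq_zero_iff] at h2
  have h3 := hX.cliqueGate_mem hyx z
  rw [h2] at h3
  by_cases hxz : x = z
  · exact Or.inl hxz
  · exact Or.inr (hX.edgeClique_adj hyx (right_mem_edgeClique y x) h3 hxz)

lemma edgeHyp_ne_of_square {a b c d : V} (h : IsSquare X a b c d) :
    edgeHyp h.ab ≠ edgeHyp h.da.symm := fun e =>
  (hX.eq_or_adj_of_edgeHyp_eq h.ab h.da.symm e.symm).elim h.ne_bd h.not_bd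

lemma exists_nearer_square {y a b c d : V} (h : IsSquare X a b c d)
    (hle : X.dist y b ≤ X.dist y a) :
    ∃ (a' b' c' d' : V) (h' : IsSquare X a' b' c' d'), edgeHyp h'.ab = edgeHyp h.ab ∧
      edgeHyp h'.da.symm = edgeHyp h.da.symm ∧ X.dist y a' < X.dist y a := by
  rcases hle.lt_or_eq with hlt | he
  · exact ⟨b, a, d, c, h.swap, edgeHyp_symm h.ab, (edgeHyp_square' h).symm, hlt⟩
  · obtain ⟨z, hza, hzb, hz⟩ := hX.triangle y a b h.ab he.symm
    obtain ⟨e, s, -⟩ := hX.prism h hza hzb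
    exact ⟨z, a, d, e, s.swap, (edgeHyp_symm hza.symm).trans (edgeHyp_triangle hza.symm hzb h.ab),
      (edgeHyp_square' s).symm, by omega⟩

/-- Guarantees that a step from a towards y is a step towards the gate of a, as `exists_ladder`
requires. -/
lemma cliqueGate_eq_of_farther {x y a b : V} (hyx : X.Adj y x) (hab : X.Adj a b)
    (he : edgeHyp hab = edgeHyp hyx) (hd : X.dist y b = X.dist y a + 1) :
    cliqueGate X y x a = y := by
  have h1 := (hX.edgeHyp_eq_iff hyx hab).1 he
  have h2 := hX.dist_cliqueGate_eq hyx hab h1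
  by_contra hne
  have h3 := hX.dist_of_ne_cliqueGate hyx (left_mem_edgeClique y x) (Ne.symm hne)
  by_cases h4 : y = cliqueGate X y x b
  · rw [← h4] at h2
    omega
  · have := hX.dist_of_ne_cliqueGate hyx (left_mem_edgeClique y x) h4
    omega

/-- If a is not the corner strictly nearest to y, the square can be flipped or slid along a prism.
Otherwise push it one step towards y: the ladders over its two sides at a, together with the
quadrangle condition seen from c, complete a cube whose opposite face starts at a'. -/
lemma exists_nearer_square' {x y z a b c d : V} (hyx : X.Adj y x) (hyz : X.Adj y z)
    (h : IsSquare X a b c d) (h1 : edgeHyp h.ab = edgeHyp hyx)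
    (h2 : edgeHyp h.da.symm = edgeHyp hyz) (hne : y ≠ a) :
    ∃ (a' b' c' d' : V) (h' : IsSquare X a' b' c' d'), edgeHyp h'.ab = edgeHyp h.ab ∧
      edgeHyp h'.da.symm = edgeHyp h.da.symm ∧ X.dist y a' < X.dist y a := by
  rcases Nat.lt_or_ge (X.dist y a) (X.dist y b) with hb | hb
  swap
  · exact hX.exists_nearer_square h hb
  rcases Nat.lt_or_ge (X.dist y a) (X.dist y d) with hd | hd
  swap
  · obtain ⟨a', b', c', d', h', e1, e2, e3⟩ := hX.exists_nearer_square h.reflect hd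
    exact ⟨a', d', c', b', h'.reflect, e2, e1, e3⟩
  have hb' := hX.dist_le_succ y h.ab
  have hd' := hX.dist_le_succ y h.da.symm
  have hc := hX.square_dist_far y h (by omega) (by omega)
  have g1 := hX.cliqueGate_eq_of_farther hyx h.ab h1 (by omega)
  have g2 := hX.cliqueGate_eq_of_farther hyz h.da.symm h2 (by omega)
  obtain ⟨a', ha', hda⟩ := hX.exists_closer hne
  obtain ⟨w, s1, -⟩ := hX.exists_ladder hyx h.ab ((hX.edgeHyp_eq_iff hyx h.ab).1 h1) ha'
    (by rw [g1]; exact hda)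
  obtain ⟨t, s2, -⟩ := hX.exists_ladder hyz h.da.symm
    ((hX.edgeHyp_eq_iff hyz h.da.symm).1 h2) ha' (by rw [g2]; exact hda)
  have e1 : edgeHyp s1.bc = edgeHyp h.ab := (edgeHyp_square' s1).symm
  have e2 : edgeHyp s2.bc = edgeHyp h.da.symm := (edgeHyp_square' s2).symm
  have hJ := hX.edgeHyp_ne_of_square h
  have hwt : w ≠ t := by
    rintro rfl
    exact hJ (e1.symm.trans e2)
  have nwt : ¬ X.Adj w t := fun k =>
    hJ (e1.symm.trans ((edgeHyp_triangle s1.bc k s2.bc).trans e2))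
  have dw := hX.dist_le_succ y s1.bc
  have dt := hX.dist_le_succ y s2.bc
  have d1 : X.dist c w = 2 := by
    refine hX.dist_eq_two h.bc.symm s1.cd.symm (by rintro rfl; omega) fun k => ?_
    exact hX.not_adj_of_dist (a := y) (by omega) k.symm
  have d2 : X.dist c t = 2 := by
    refine hX.dist_eq_two h.cd s2.cd.symm (by rintro rfl; omega) fun k => ?_
    exact hX.not_adj_of_dist (a := y) (by omega) k.symm
  -- Seen from y, the vertex c is two levels above a and a' one below.
  have d3 : X.dist c a' = 3 := by
    have k1 := hX.dist_le_succ c s1.bc.symm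
    have k2 := hX.connected.dist_triangle (u := y) (v := a') (w := c)
    rw [SimpleGraph.dist_comm (u := a')] at k2
    omega
  obtain ⟨u, huw, hut, hu⟩ := hX.quadrangle c w t a' hwt s1.bc s2.bc (by omega) (by omega)
  have s : IsSquare X a' w u t := by
    refine ⟨s1.bc, huw.symm, hut, s2.bc.symm, by rintro rfl; omega, hwt, fun k => ?_, nwt⟩
    exact hX.not_adj_of_dist (a := c) (by omega) k.symm
  exact ⟨a', w, u, t, s, e1, e2, by omega⟩

/-- Edges at y dual to the same hyperplane lie in one clique, and a prism replaces one by the other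
as a side of the square. -/
lemma exists_square_of_edgeHyp_eq {y b c d x : V} (h : IsSquare X y b c d) (hyx : X.Adj y x)
    (he : edgeHyp h.ab = edgeHyp hyx) : ∃ e, IsSquare X y x e d := by
  rcases hX.eq_or_adj_of_edgeHyp_eq hyx h.ab he with rfl | hxb
  · exact ⟨c, h⟩
  · obtain ⟨e, s, -⟩ := hX.prism h hyx.symm hxb
    exact ⟨e, s⟩

/-- Two edges sharing a vertex and dual to transverse hyperplanes span a square. -/
theorem exists_square {x y z : V} (hyx : X.Adj y x) (hyz : X.Adj y z)
    (ht : (edgeHyp hyx).Transverse (edgeHyp hyz)) : ∃ w, IsSquare X y x w z := by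
  -- Among the squares crossing both hyperplanes, the corner is brought to y by descent on its
  -- distance to y.
  have key : ∀ (n : ℕ) (a b c d : V) (h : IsSquare X a b c d), edgeHyp h.ab = edgeHyp hyx →
      edgeHyp h.da.symm = edgeHyp hyz → X.dist y a = n → ∃ w, IsSquare X y x w z := by
    intro n
    induction n using Nat.strong_induction_on with
    | _ n ih =>
      intro a b c d h h1 h2 hn
      by_cases hne : y = a
      · subst hne
        obtain ⟨e, s⟩ := hX.exists_square_of_edgeHyp_eq h hyx h1
        obtain ⟨f, s'⟩ := hX.exists_square_of_edgeHyp_eq s.reflect hyz h2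
        exact ⟨f, s'.reflect⟩
      · obtain ⟨a', b', c', d', h', e1, e2, e3⟩ :=
          hX.exists_nearer_square' hyx hyz h h1 h2 hne
        exact ih _ (by omega) a' b' c' d' h' (e1.trans h1) (e2.trans h2) rfl
  obtain ⟨a, b, c, d, h, h1, h2⟩ := ht
  obtain ⟨h1', h1⟩ := mem_edges_iff.1 h1
  obtain ⟨h2', h2⟩ := mem_edges_iff.1 h2
  exact key _ a b c d h h1 h2 rfl

end IsQuasiMedian
end Gates
end QuasiMedian

namespace QuasiMedian

namespace GraphProduct

/-! ### Normal forms in graph products. -/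

section NormalForm

variable {I : Type*} (Γ : SimpleGraph I) (𝒢 : I → Type*)

/-- A word in the vertex-groups, up to the commutations given by `Γ`, is recorded by its
restrictions to all pairs of non-adjacent vertices. -/
abbrev State : Type _ := I → I → List (Σ i, 𝒢 i)

variable {𝒢}

open Classical in
/-- Add a letter at the beginning of a word. -/
noncomputable def push {u : I} (g : 𝒢 u) (p : State 𝒢) : State 𝒢 := fun a b =>
  -- Entries at adjacent pairs are never touched. Diagonal pairs count as non-adjacent, so every
  -- letter is recorded at least once.
  if ¬ Γ.Adj a b ∧ (a = u ∨ b = u) then ⟨u, g⟩ :: p a b else p a b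

/-- A letter of `𝒢 u` can be moved to the beginning of the word. -/
def Head (u : I) (p : State 𝒢) : Prop := ∀ b, ¬ Γ.Adj u b → ∃ h : 𝒢 u, ∃ t, p u b = ⟨u, h⟩ :: t

variable {Γ}

lemma push_of_touch {u a b : I} (g : 𝒢 u) (p : State 𝒢) (h : ¬ Γ.Adj a b) (h' : a = u ∨ b = u) :
    push Γ g p a b = ⟨u, g⟩ :: p a b := if_pos ⟨h, h'⟩

lemma push_of_not_touch {u a b : I} (g : 𝒢 u) (p : State 𝒢)
    (h : ¬ Γ.Adj a b → a ≠ u ∧ b ≠ u) : push Γ g p a b = p a b :=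
  if_neg fun h' => h'.2.elim (h h'.1).1 (h h'.1).2

lemma head_push_self {u : I} (g : 𝒢 u) (p : State 𝒢) : Head Γ u (push Γ g p) := fun b hb =>
  ⟨g, p u b, push_of_touch g p hb (Or.inl rfl)⟩

lemma head_push_iff {u v : I} (h : Γ.Adj u v) (g : 𝒢 v) (p : State 𝒢) :
    Head Γ u (push Γ g p) ↔ Head Γ u p := by
  refine forall_congr' fun b => imp_congr_right fun hb => ?_
  rw [push_of_not_touch]
  exact fun _ => ⟨h.ne, fun e => hb (e ▸ h)⟩

/-- Otherwise the list at the pair (u, v) would begin with a letter of v. -/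
lemma adj_of_head_push {u v : I} (huv : u ≠ v) {g : 𝒢 v} {p : State 𝒢}
    (h : Head Γ u (push Γ g p)) : Γ.Adj u v := by
  by_contra hadj
  obtain ⟨k, t, e⟩ := h v hadj
  rw [push_of_touch g p hadj (Or.inr rfl), List.cons.injEq] at e
  exact huv (congrArg Sigma.fst e.1).symm

lemma push_comm {u v : I} (h : Γ.Adj u v) (g : 𝒢 u) (k : 𝒢 v) (p : State 𝒢) :
    push Γ g (push Γ k p) = push Γ k (push Γ g p) := by
  funext a b
  by_cases hab : Γ.Adj a b
  · simp [push, hab]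
  · have h1 : ¬ ((a = u ∨ b = u) ∧ (a = v ∨ b = v)) := by
      rintro ⟨rfl | rfl, rfl | rfl⟩
      · exact h.ne rfl
      · exact hab h
      · exact hab h.symm
      · exact h.ne rfl
    by_cases hu : a = u ∨ b = u
    · have hv : ¬ (a = v ∨ b = v) := fun hv => h1 ⟨hu, hv⟩
      simp only [push, hab, hu, hv, not_false_eq_true, and_true, if_true, and_false, if_false]
    · simp only [push, hu, and_false, if_false]

lemma push_injective {u : I} {g k : 𝒢 u} {p q : State 𝒢} (h : push Γ g p = push Γ k q) :
    g = k ∧ p = q := by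
  constructor
  · have := congrFun (congrFun h u) u
    rw [push_of_touch g p Γ.irrefl (Or.inl rfl), push_of_touch k q Γ.irrefl (Or.inl rfl),
      List.cons.injEq] at this
    exact eq_of_heq (Sigma.mk.inj this.1).2
  · funext a b
    have := congrFun (congrFun h a) b
    unfold push at this
    split_ifs at this
    · exact (List.cons.inj this).2
    · exact this

variable [∀ i, Group (𝒢 i)]

lemma commute_of {u v : I} (h : Γ.Adj u v) (g : 𝒢 u) (k : 𝒢 v) :
    of Γ 𝒢 u g * of Γ 𝒢 v k = of Γ 𝒢 v k * of Γ 𝒢 u g := by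
  have h1 : (QuotientGroup.mk' (Subgroup.normalClosure (graphProductRels Γ 𝒢)))
      (Monoid.CoprodI.of g * Monoid.CoprodI.of k * (Monoid.CoprodI.of g)⁻¹ *
        (Monoid.CoprodI.of k)⁻¹) = 1 :=
    (QuotientGroup.eq_one_iff _).2 (Subgroup.subset_normalClosure ⟨u, v, h, g, k, rfl⟩)
  simp only [map_mul, map_inv] at h1
  rw [mul_inv_eq_one, mul_inv_eq_iff_eq_mul] at h1
  exact h1

lemma of_induction {P : GraphProduct Γ 𝒢 → Prop} (one : P 1)
    (step : ∀ (u : I) (g : 𝒢 u) (h : GraphProduct Γ 𝒢), P h → P (of Γ 𝒢 u g * h))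
    (h : GraphProduct Γ 𝒢) : P h := by
  obtain ⟨w, rfl⟩ := QuotientGroup.mk'_surjective _ h
  induction w using Monoid.CoprodI.induction_left with
  | one => rw [map_one]; exact one
  | mul m x ih => rw [map_mul]; exact step _ m _ ih

variable (Γ) in
/-- `Reduced n h p`: there is a reduced word of length `n` which represents `h` and is recorded
by `p`. -/
inductive Reduced : ℕ → GraphProduct Γ 𝒢 → State 𝒢 → Prop
  | one : Reduced 0 1 (fun _ _ => [])
  | step {n : ℕ} {h : GraphProduct Γ 𝒢} {p : State 𝒢} {u : I} (g : 𝒢 u) :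
      Reduced n h p → g ≠ 1 → ¬ Head Γ u p → Reduced (n + 1) (of Γ 𝒢 u g * h) (push Γ g p)

/-- The letter of u commutes with every letter that precedes it, so it can be shuffled to the front
without changing the record. -/
lemma Reduced.exists_head {n : ℕ} {h : GraphProduct Γ 𝒢} {p : State 𝒢} (hr : Reduced Γ n h p)
    {u : I} (hu : Head Γ u p) : ∃ (g : 𝒢 u) (m : ℕ) (k : GraphProduct Γ 𝒢) (q : State 𝒢),
      g ≠ 1 ∧ n = m + 1 ∧ h = of Γ 𝒢 u g * k ∧ p = push Γ g q ∧ Reduced Γ m k q ∧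
        ¬ Head Γ u q := by
  induction hr with
  | one =>
    obtain ⟨g, t, e⟩ := hu u Γ.irrefl
    exact absurd e (by simp)
  | @step n h p v g hr hg hv ih =>
    by_cases huv : u = v
    · subst huv
      exact ⟨g, n, h, p, hg, rfl, rfl, rfl, hr, hv⟩
    · have hadj := adj_of_head_push huv hu
      rw [head_push_iff hadj] at hu
      obtain ⟨k, m, h', q, hk, rfl, rfl, rfl, hr', hu'⟩ := ih hu
      rw [head_push_iff hadj.symm] at hv
      refine ⟨k, m + 1, of Γ 𝒢 v g * h', push Γ g q, hk, rfl, ?_, push_comm hadj.symm _ _ _,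
        hr'.step g hg hv, ?_⟩
      · rw [← mul_assoc, commute_of hadj.symm, mul_assoc]
      · rwa [head_push_iff hadj]

lemma Reduced.length_unique {n : ℕ} {h : GraphProduct Γ 𝒢} {p : State 𝒢} (hr : Reduced Γ n h p) :
    ∀ {m : ℕ} {k : GraphProduct Γ 𝒢}, Reduced Γ m k p → m = n := by
  induction hr with
  | one =>
    intro m k hk
    generalize hq : (fun _ _ => [] : State 𝒢) = q at hk
    cases hk with
    | one => rfl
    | @step _ _ p u g =>
      have := congrFun (congrFun hq u) u
      rw [push_of_touch _ _ Γ.irrefl (Or.inl rfl)] at this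
      exact absurd this (by simp)
  | step g hr hg hv ih =>
    intro m k hk
    obtain ⟨g', m', k', q, -, rfl, -, e, hk', -⟩ := hk.exists_head (head_push_self g _)
    obtain ⟨-, rfl⟩ := push_injective e
    rw [ih hk']

/-- The new letter either lengthens the word, or merges with or cancels a head of the same type. -/
lemma Reduced.exists_of_mul {n : ℕ} {h : GraphProduct Γ 𝒢} {p : State 𝒢} (hr : Reduced Γ n h p)
    {u : I} (g : 𝒢 u) : ∃ m ≤ n + 1, ∃ q, Reduced Γ m (of Γ 𝒢 u g * h) q := by
  by_cases hg : g = 1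
  · subst hg
    exact ⟨n, by omega, p, by rwa [map_one, one_mul]⟩
  by_cases hu : Head Γ u p
  · obtain ⟨k, m, h', q, -, rfl, rfl, rfl, hr', hu'⟩ := hr.exists_head hu
    by_cases hgk : g * k = 1
    · refine ⟨m, by omega, q, ?_⟩
      rwa [← mul_assoc, ← map_mul, hgk, map_one, one_mul]
    · refine ⟨m + 1, by omega, push Γ (g * k) q, ?_⟩
      rw [← mul_assoc, ← map_mul]
      exact hr'.step _ hgk hu'
  · exact ⟨n + 1, le_rfl, _, hr.step g hg hu⟩

variable (Γ 𝒢) in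
/-- The records of reduced words. -/
abbrev NormalState : Type _ := {p : State 𝒢 // ∃ n h, Reduced Γ n h p}

open Classical in
/-- A reduced word is uniquely the product of a possibly trivial element of `𝒢 u` and of a reduced
word with no head in `𝒢 u`. -/
noncomputable def normalCons (u : I)
    (x : 𝒢 u × {p : NormalState Γ 𝒢 // ¬ Head Γ u p.1}) : NormalState Γ 𝒢 :=
  if hg : x.1 = 1 then x.2.1 else
    ⟨push Γ x.1 x.2.1.1, by
      obtain ⟨n, h, hr⟩ := x.2.1.2
      exact ⟨_, _, hr.step x.1 hg x.2.2⟩⟩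

lemma normalCons_one {u : I} (p : {p : NormalState Γ 𝒢 // ¬ Head Γ u p.1}) :
    normalCons u (1, p) = p.1 := dif_pos rfl

lemma normalCons_val {u : I} {g : 𝒢 u} (hg : g ≠ 1)
    (p : {p : NormalState Γ 𝒢 // ¬ Head Γ u p.1}) :
    (normalCons u (g, p)).1 = push Γ g p.1.1 := by
  simp only [normalCons, dif_neg hg]

/-- Sets up van der Waerden's trick: through this bijection each vertex-group acts on normal forms
by left multiplication on the first factor, without prior knowledge of the graph product. -/
lemma normalCons_bijective (u : I) :
    Function.Bijective (normalCons (Γ := Γ) (𝒢 := 𝒢) u) := by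
  constructor
  · rintro ⟨g, p⟩ ⟨k, q⟩ h
    by_cases hg : g = 1 <;> by_cases hk : k = 1
    · subst hg hk
      rw [normalCons_one, normalCons_one] at h
      rw [Subtype.ext h]
    · subst hg
      refine absurd ?_ p.2
      rw [normalCons_one] at h
      rw [h, normalCons_val hk]
      exact head_push_self _ _
    · subst hk
      refine absurd ?_ q.2
      rw [normalCons_one] at h
      rw [← h, normalCons_val hg]
      exact head_push_self _ _
    · have h' := congrArg Subtype.val h
      rw [normalCons_val hg, normalCons_val hk] at h'
      obtain ⟨rfl, e⟩ := push_injective h'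
      rw [Subtype.ext (Subtype.ext e)]
  · intro p
    by_cases hp : Head Γ u p.1
    · obtain ⟨n, h, hr⟩ := p.2
      obtain ⟨g, m, k, q, hg, -, -, e, hk, hq⟩ := hr.exists_head hp
      exact ⟨(g, ⟨⟨q, m, k, hk⟩, hq⟩), Subtype.ext ((normalCons_val hg _).trans e.symm)⟩
    · exact ⟨(1, ⟨p, hp⟩), normalCons_one _⟩

/-- The action of a vertex-group on reduced words. -/
noncomputable def vertexAction (u : I) : 𝒢 u →* Equiv.Perm (NormalState Γ 𝒢) where
  toFun g := (Equiv.ofBijective _ (normalCons_bijective u)).permCongr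
    ((Equiv.mulLeft g).prodCongr (Equiv.refl _))
  map_one' := by
    ext1 p
    simp [Equiv.permCongr_apply]
  map_mul' g k := by
    ext1 p
    simp only [Equiv.permCongr_apply, Equiv.Perm.mul_apply, Equiv.symm_apply_apply]
    simp only [Equiv.prodCongr_apply, Equiv.coe_mulLeft, Equiv.coe_refl, Equiv.ofBijective_apply,
      Prod.map_apply', mul_assoc]
    rfl

lemma vertexAction_normalCons {u : I} (g k : 𝒢 u)
    (p : {p : NormalState Γ 𝒢 // ¬ Head Γ u p.1}) :
    vertexAction u g (normalCons u (k, p)) = normalCons u (g * k, p) := by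
  have : (Equiv.ofBijective _ (normalCons_bijective u)).symm (normalCons u (k, p)) = (k, p) :=
    (Equiv.ofBijective _ (normalCons_bijective u)).symm_apply_apply (k, p)
  simp [vertexAction, Equiv.permCongr_apply, this]

lemma not_head_normalCons {u v : I} (h : Γ.Adj u v) (k : 𝒢 v)
    (p : {p : NormalState Γ 𝒢 // ¬ Head Γ v p.1}) (hp : ¬ Head Γ u p.1.1) :
    ¬ Head Γ u (normalCons v (k, p)).1 := by
  by_cases hk : k = 1
  · subst hk
    rwa [normalCons_one]
  · rwa [normalCons_val hk, head_push_iff h]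

lemma normalCons_comm {u v : I} (h : Γ.Adj u v) (g : 𝒢 u) (k : 𝒢 v) (p : NormalState Γ 𝒢)
    (hu : ¬ Head Γ u p.1) (hv : ¬ Head Γ v p.1) :
    normalCons u (g, ⟨normalCons v (k, ⟨p, hv⟩), not_head_normalCons h k _ hu⟩) =
      normalCons v (k, ⟨normalCons u (g, ⟨p, hu⟩), not_head_normalCons h.symm g _ hv⟩) := by
  refine Subtype.ext ?_
  by_cases hg : g = 1 <;> by_cases hk : k = 1
  · subst hg hk
    simp only [normalCons_one]
  · subst hg
    simp only [normalCons_one]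
  · subst hk
    simp only [normalCons_one]
  · simp only [normalCons_val hg, normalCons_val hk]
    exact push_comm h g k _

lemma vertexAction_comm {u v : I} (h : Γ.Adj u v) (g : 𝒢 u) (k : 𝒢 v) :
    vertexAction (Γ := Γ) u g * vertexAction v k = vertexAction v k * vertexAction u g := by
  ext1 p
  obtain ⟨⟨a, ⟨q, hq⟩⟩, rfl⟩ := (normalCons_bijective u).2 p
  obtain ⟨⟨b, ⟨r, hr⟩⟩, rfl⟩ := (normalCons_bijective v).2 q
  -- Both heads have been split off, so the two actions now modify independent coordinates over the
  -- same remainder r.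
  have hru : ¬ Head Γ u r.1 := by
    by_cases hb : b = 1
    · subst hb
      rwa [normalCons_one] at hq
    · rwa [normalCons_val hb, head_push_iff h] at hq
  rw [Equiv.Perm.mul_apply, Equiv.Perm.mul_apply, vertexAction_normalCons,
    normalCons_comm h _ _ _ hru hr, normalCons_comm h _ _ _ hru hr, vertexAction_normalCons,
    vertexAction_normalCons, ← normalCons_comm h _ _ _ hru hr, ← normalCons_comm h _ _ _ hru hr,
    vertexAction_normalCons]

variable (Γ 𝒢) in
/-- The action of the graph product on reduced words. -/
noncomputable def action : GraphProduct Γ 𝒢 →* Equiv.Perm (NormalState Γ 𝒢) :=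
  QuotientGroup.lift _ (Monoid.CoprodI.lift vertexAction) (by
    refine Subgroup.normalClosure_le_normal ?_
    rintro _ ⟨u, v, h, g, k, rfl⟩
    rw [SetLike.mem_coe, MonoidHom.mem_ker]
    simp only [map_mul, map_inv, Monoid.CoprodI.lift_of]
    rw [vertexAction_comm h, mul_inv_cancel_right, mul_inv_cancel])

lemma action_of (u : I) (g : 𝒢 u) : action Γ 𝒢 (of Γ 𝒢 u g) = vertexAction u g := by
  change Monoid.CoprodI.lift vertexAction (Monoid.CoprodI.of g) = _
  rw [Monoid.CoprodI.lift_of]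

/-- The record of the reduced words representing `h`. -/
noncomputable def state (h : GraphProduct Γ 𝒢) : State 𝒢 :=
  (action Γ 𝒢 h ⟨fun _ _ => [], 0, 1, Reduced.one⟩).1

/-- Acting on the empty word rebuilds a reduced word letter by letter, so its record depends only on
the element it represents. -/
lemma Reduced.state_eq {n : ℕ} {h : GraphProduct Γ 𝒢} {p : State 𝒢} (hr : Reduced Γ n h p) :
    state h = p := by
  induction hr with
  | one =>
    unfold state
    rw [map_one]
    rfl
  | @step n h p u g hr hg hu ih =>
    unfold state at ih ⊢
    have e : action Γ 𝒢 h ⟨fun _ _ => [], 0, 1, Reduced.one⟩ = ⟨p, n, h, hr⟩ := Subtype.ext ih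
    have e' := vertexAction_normalCons g 1 ⟨⟨p, n, h, hr⟩, hu⟩
    rw [normalCons_one, mul_one] at e'
    rw [map_mul, action_of, Equiv.Perm.mul_apply, e, e', normalCons_val hg]

end NormalForm

/-! ### Word length and distances in `graphProductQM`. -/

section Length

variable {I : Type*} {Γ : SimpleGraph I} {𝒢 : I → Type*} [∀ i, Group (𝒢 i)]

lemma exists_of_qm_adj {x y : GraphProduct Γ 𝒢} (h : (graphProductQM Γ 𝒢).Adj x y) :
    ∃ (u : I) (g : 𝒢 u), y = x * of Γ 𝒢 u g := by
  obtain ⟨-, s, hs, h⟩ := (SimpleGraph.mulCayley_adj' _ _ _).1 h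
  obtain ⟨u, g, -, rfl⟩ := Set.mem_iUnion.1 hs
  rcases h with rfl | rfl
  · exact ⟨u, g, rfl⟩
  · exact ⟨u, g⁻¹, by rw [map_inv, mul_inv_cancel_right]⟩

lemma qm_eq_or_adj (x : GraphProduct Γ 𝒢) {u : I} (g : 𝒢 u) :
    x = x * of Γ 𝒢 u g ∨ (graphProductQM Γ 𝒢).Adj x (x * of Γ 𝒢 u g) := by
  by_cases hg : g = 1
  · subst hg
    simp
  · by_cases h : x = x * of Γ 𝒢 u g
    · exact Or.inl h
    · exact Or.inr ((SimpleGraph.mulCayley_adj' _ _ _).2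
        ⟨h, _, Set.mem_iUnion.2 ⟨u, g, hg, rfl⟩, Or.inl rfl⟩)

lemma Reduced.exists_walk {n : ℕ} {h : GraphProduct Γ 𝒢} {p : State 𝒢} (hr : Reduced Γ n h p) :
    ∀ x, ∃ w : (graphProductQM Γ 𝒢).Walk x (x * h), w.length ≤ n := by
  induction hr with
  | one => exact fun x => ⟨SimpleGraph.Walk.nil.copy rfl (mul_one x).symm, by simp⟩
  | step g hr hg hu ih =>
    intro x
    obtain ⟨w, hw⟩ := ih (x * of Γ 𝒢 _ g)
    rcases qm_eq_or_adj x g with e | e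
    · exact ⟨w.copy e.symm (mul_assoc _ _ _), by rw [SimpleGraph.Walk.length_copy]; omega⟩
    · refine ⟨(SimpleGraph.Walk.cons e w).copy rfl (mul_assoc _ _ _), ?_⟩
      rw [SimpleGraph.Walk.length_copy, SimpleGraph.Walk.length_cons]
      omega

lemma exists_reduced (h : GraphProduct Γ 𝒢) : ∃ n p, Reduced Γ n h p := by
  refine of_induction (Γ := Γ) (𝒢 := 𝒢) (P := fun h => ∃ n p, Reduced Γ n h p)
    ⟨0, _, Reduced.one⟩ ?_ h
  rintro u g h ⟨n, p, hr⟩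
  obtain ⟨m, -, q, hq⟩ := hr.exists_of_mul g
  exact ⟨m, q, hq⟩

lemma exists_reduced_of_walk {x y : GraphProduct Γ 𝒢} (w : (graphProductQM Γ 𝒢).Walk x y) :
    ∃ n ≤ w.length, ∃ p, Reduced Γ n (x⁻¹ * y) p := by
  induction w with
  | nil => exact ⟨0, le_rfl, _, by rw [inv_mul_cancel]; exact Reduced.one⟩
  | @cons x z y e w ih =>
    obtain ⟨n, hn, p, hr⟩ := ih
    obtain ⟨u, g, rfl⟩ := exists_of_qm_adj e
    obtain ⟨m, hm, q, hq⟩ := hr.exists_of_mul g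
    refine ⟨m, by rw [SimpleGraph.Walk.length_cons]; omega, q, ?_⟩
    convert hq using 1
    group

lemma qm_connected : (graphProductQM Γ 𝒢).Connected := by
  have : Nonempty (GraphProduct Γ 𝒢) := ⟨1⟩
  refine SimpleGraph.Connected.mk fun x y => ?_
  obtain ⟨n, p, hr⟩ := exists_reduced (x⁻¹ * y)
  obtain ⟨w, -⟩ := hr.exists_walk x
  rw [mul_inv_cancel_left] at w
  exact w.reachable

variable (Γ 𝒢) in
/-- The word length with respect to the union of the vertex-groups. -/
noncomputable def len (h : GraphProduct Γ 𝒢) : ℕ := (graphProductQM Γ 𝒢).dist 1 h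

/-- A geodesic gives a reduced word that is no longer than itself; this word has the same record,
hence the same length, as the given one. -/
lemma Reduced.dist_eq {n : ℕ} {x y : GraphProduct Γ 𝒢} {p : State 𝒢}
    (hr : Reduced Γ n (x⁻¹ * y) p) : (graphProductQM Γ 𝒢).dist x y = n := by
  obtain ⟨w, hw⟩ := hr.exists_walk x
  have h1 := (SimpleGraph.dist_le w).trans hw
  rw [mul_inv_cancel_left] at h1
  obtain ⟨v, hv⟩ := qm_connected.exists_walk_length_eq_dist x y
  obtain ⟨m, hm, q, hq⟩ := exists_reduced_of_walk v
  have hpq : p = q := hr.state_eq.symm.trans hq.state_eq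
  subst hpq
  have := hr.length_unique hq
  omega

lemma Reduced.len_eq {n : ℕ} {h : GraphProduct Γ 𝒢} {p : State 𝒢} (hr : Reduced Γ n h p) :
    len Γ 𝒢 h = n :=
  Reduced.dist_eq (p := p) (by rwa [inv_one, one_mul])

lemma reduced_len (h : GraphProduct Γ 𝒢) : Reduced Γ (len Γ 𝒢 h) h (state h) := by
  obtain ⟨n, p, hr⟩ := exists_reduced h
  rwa [hr.len_eq, hr.state_eq]

lemma dist_eq_len (x y : GraphProduct Γ 𝒢) :
    (graphProductQM Γ 𝒢).dist x y = len Γ 𝒢 (x⁻¹ * y) :=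
  (reduced_len (x⁻¹ * y)).dist_eq

/-- Some reduced word representing `h` begins with a letter of `𝒢 u`. -/
def HasHead (u : I) (h : GraphProduct Γ 𝒢) : Prop := Head Γ u (state h)

lemma len_of_mul {u : I} {g : 𝒢 u} {h : GraphProduct Γ 𝒢} (hg : g ≠ 1) (hu : ¬ HasHead u h) :
    len Γ 𝒢 (of Γ 𝒢 u g * h) = len Γ 𝒢 h + 1 :=
  ((reduced_len h).step g hg hu).len_eq

lemma HasHead.exists_eq {u : I} {h : GraphProduct Γ 𝒢} (hu : HasHead u h) :
    ∃ (g : 𝒢 u) (k : GraphProduct Γ 𝒢), h = of Γ 𝒢 u g * k ∧ len Γ 𝒢 k + 1 = len Γ 𝒢 h := by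
  obtain ⟨g, m, k, q, -, hm, e, -, hr, -⟩ := (reduced_len h).exists_head hu
  exact ⟨g, k, e, by rw [hr.len_eq, hm]⟩

lemma HasHead.of_of_mul {u v : I} {g : 𝒢 v} {h : GraphProduct Γ 𝒢} (hg : g ≠ 1)
    (hv : ¬ HasHead v h) (huv : u ≠ v) (hu : HasHead u (of Γ 𝒢 v g * h)) :
    Γ.Adj u v ∧ HasHead u h := by
  unfold HasHead at hu
  rw [((reduced_len h).step g hg hv).state_eq] at hu
  have hadj := adj_of_head_push huv hu
  exact ⟨hadj, (head_push_iff hadj g _).1 hu⟩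

end Length
end GraphProduct
end QuasiMedian

namespace QuasiMedian

/-! ### Integrating labels over a quasi-median graph. -/

section Potential

variable {V H : Type*} {X : SimpleGraph V} [Group H]

/-- A labelling of oriented edges which is multiplicative along triangles and squares is the
coboundary of a function on vertices. -/
theorem IsQuasiMedian.exists_potential (hX : IsQuasiMedian X) (lab : V → V → H)
    (hsymm : ∀ a b, X.Adj a b → lab a b * lab b a = 1)
    (htri : ∀ a b c, X.Adj a b → X.Adj b c → X.Adj a c → lab a b * lab b c = lab a c)
    (hsq : ∀ a b c d, IsSquare X a b c d → lab a b * lab b c = lab a d * lab d c) :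
    ∃ Φ : V → H, ∀ x y, X.Adj x y → Φ y = Φ x * lab x y := by
  obtain ⟨o⟩ := hX.connected.nonempty
  have hpr : ∀ x, ∃ y, o ≠ x → X.Adj x y ∧ X.dist o y + 1 = X.dist o x := fun x => by
    by_cases h : o = x
    · exact ⟨x, fun h' => absurd h h'⟩
    · obtain ⟨y, hy⟩ := hX.exists_closer h
      exact ⟨y, fun _ => hy⟩
  choose pr hpr using hpr
  -- Multiplies labels along the chosen descending path to the base vertex; the natural number is
  -- the recursion depth, equal to the distance in Φ.
  let Ψ : ℕ → V → H := fun n => n.rec (fun _ => 1) fun _ f x => f (pr x) * lab (pr x) x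
  let Φ : V → H := fun x => Ψ (X.dist o x) x
  have hΦ : ∀ x, o ≠ x → Φ x = Φ (pr x) * lab (pr x) x := fun x hx => by
    change Ψ (X.dist o x) x = Ψ (X.dist o (pr x)) (pr x) * _
    rw [← (hpr x hx).2]
  have key : ∀ (n : ℕ) (x y : V), X.Adj x y → X.dist o y + 1 = X.dist o x → X.dist o x = n →
      Φ x = Φ y * lab y x := by
    intro n
    induction n using Nat.strong_induction_on with
    | _ n ih =>
      intro x y hxy hd hn
      have hx : o ≠ x := by
        rintro rfl
        rw [SimpleGraph.dist_self] at hd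
        omega
      obtain ⟨h1, h2⟩ := hpr x hx
      by_cases he : pr x = y
      · rw [hΦ x hx, he]
      -- Two predecessors of x span a square with a vertex w two levels down, so the value at x does
      -- not depend on the predecessor used.
      obtain ⟨w, hw1, hw2, hw⟩ := hX.quadrangle o (pr x) y x he h1 hxy h2 hd
      have hwx : w ≠ x := by rintro rfl; omega
      have hs : IsSquare X w (pr x) x y := by
        refine ⟨hw1, h1.symm, hxy, hw2.symm, hwx, he, ?_, fun k => ?_⟩
        · exact hX.not_adj_of_dist (a := o) (by omega)
        · exact hX.not_adj_of_dist (a := o) (by omega) (hX.adj_of_common k hw1 hw2 h1 hxy hwx)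
      rw [hΦ x hx, ih (n - 1) (by omega) (pr x) w hw1.symm (by omega) (by omega),
        ih (n - 1) (by omega) y w hw2.symm (by omega) (by omega), mul_assoc, mul_assoc,
        hsq _ _ _ _ hs]
  refine ⟨Φ, fun x y hxy => ?_⟩
  have h1 := hX.dist_le_succ o hxy
  have h2 := hX.dist_le_succ o hxy.symm
  rcases Nat.lt_trichotomy (X.dist o x) (X.dist o y) with h | h | h
  · exact key _ y x hxy.symm (by omega) rfl
  · obtain ⟨z, hzx, hzy, hz⟩ := hX.triangle o x y hxy h
    rw [key _ x z hzx.symm hz rfl, key _ y z hzy.symm (by omega) rfl, mul_assoc,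
      htri z x y hzx hxy hzy]
  · rw [key _ x y hxy (by omega) rfl, mul_assoc, hsymm y x hxy.symm, mul_one]

end Potential

/-! ### Coordinates for free actions. -/

section FreeActions

/-- A set on which a group acts freely is the product of the group and the set of orbits. -/
lemma exists_equiv_of_free {α K : Type*} (S : Subgroup (Equiv.Perm α))
    (hfree : ∀ σ ∈ S, ∀ x, σ x = x → σ = 1) (e : K ≃ MulAction.orbitRel.Quotient S α) :
    ∃ c : α ≃ S × K, ∀ (σ : S) (x : α), c (σ.1 x) = (σ * (c x).1, (c x).2) := by
  -- A base point is chosen in each orbit; freeness gives injectivity.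
  let f : S × K → α := fun p => p.1.1 (Quotient.out (e p.2))
  have hmk : ∀ (σ : S) (x : α), (Quotient.mk'' (σ.1 x) : MulAction.orbitRel.Quotient S α) =
      Quotient.mk'' x := fun σ x =>
    Quotient.sound' (MulAction.orbitRel_apply.2 (MulAction.mem_orbit x σ))
  have hf : Function.Bijective f := by
    constructor
    · rintro ⟨σ, k⟩ ⟨τ, l⟩ h
      have hkl : k = l := by
        have h1 := congrArg (Quotient.mk'' : α → MulAction.orbitRel.Quotient S α) h
        rw [hmk, hmk, Quotient.out_eq', Quotient.out_eq'] at h1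
        exact e.injective h1
      subst hkl
      have h2 : (τ⁻¹ * σ : S) = 1 := Subtype.ext (hfree _ (τ⁻¹ * σ).2 (Quotient.out (e k)) (by
        change τ.1⁻¹ (σ.1 _) = _
        rw [Equiv.Perm.inv_eq_iff_eq]
        exact h))
      rw [inv_mul_eq_one.1 h2]
    · intro x
      have h1 : (Quotient.mk'' (Quotient.out (Quotient.mk'' x :
          MulAction.orbitRel.Quotient S α)) : MulAction.orbitRel.Quotient S α) =
          Quotient.mk'' x := Quotient.out_eq' _
      obtain ⟨σ, hσ⟩ := MulAction.orbitRel_apply.1 (Quotient.exact' h1.symm)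
      refine ⟨(σ, e.symm (Quotient.mk'' x)), ?_⟩
      change σ.1 (Quotient.out (e (e.symm _))) = x
      rw [Equiv.apply_symm_apply]
      exact hσ
  refine ⟨(Equiv.ofBijective f hf).symm, fun σ x => ?_⟩
  rw [Equiv.symm_apply_eq]
  obtain ⟨p, rfl⟩ := hf.2 x
  rw [show (Equiv.ofBijective f hf).symm (f p) = p from
    (Equiv.ofBijective f hf).symm_apply_apply p]
  rfl

end FreeActions

/-! ### Types and labels of edges under a special action. -/

section Labels

variable {V : Type*} {X : SimpleGraph V}

/-- The sector of `J` containing `v`. -/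
def sectorMk (J : Hyperplane X) (v : V) : J.Sector := J.compl.connectedComponentMk v

lemma sectorMk_eq_iff (hX : IsQuasiMedian X) {J : Hyperplane X} {x y : V} (hxy : X.Adj x y)
    (h : edgeHyp hxy = J) {a b : V} :
    sectorMk J a = sectorMk J b ↔ cliqueGate X x y a = cliqueGate X x y b := by
  subst h
  exact SimpleGraph.ConnectedComponent.eq.trans (hX.reachable_compl_iff hxy)

lemma sectorMk_eq_of_adj {J : Hyperplane X} {a b : V} (hab : X.Adj a b) (h : edgeHyp hab ≠ J) :
    sectorMk J a = sectorMk J b := by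
  refine SimpleGraph.ConnectedComponent.eq.2 (SimpleGraph.Adj.reachable ?_)
  change (X.deleteEdges _).Adj a b
  rw [SimpleGraph.deleteEdges_adj]
  exact ⟨hab, fun ⟨_, e⟩ => h e⟩

lemma edgeHyp_map (f : X ≃g X) {x y : V} (h : X.Adj x y) :
    edgeHyp (f.map_adj_iff.2 h) = f • edgeHyp h := rfl

lemma Hyperplane.Transverse.smul (f : X ≃g X) {J₁ J₂ : Hyperplane X} (h : J₁.Transverse J₂) :
    (f • J₁).Transverse (f • J₂) := by
  obtain ⟨a, b, c, d, hs, h1, h2⟩ := h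
  exact ⟨f a, f b, f c, f d, ⟨f.map_adj_iff.2 hs.ab, f.map_adj_iff.2 hs.bc,
    f.map_adj_iff.2 hs.cd, f.map_adj_iff.2 hs.da, f.injective.ne hs.ne_ac,
    f.injective.ne hs.ne_bd, fun h => hs.not_ac (f.map_adj_iff.1 h),
    fun h => hs.not_bd (f.map_adj_iff.1 h)⟩, map_mem_edges f h1, map_mem_edges f h2⟩

lemma transverse_of_square {a b c d : V} (h : IsSquare X a b c d) :
    (edgeHyp h.ab).Transverse (edgeHyp h.da.symm) :=
  ⟨a, b, c, d, h, ⟨h.ab, rfl⟩, ⟨h.da.symm, rfl⟩⟩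

lemma carrier_inter_nonempty {x y z : V} (hxy : X.Adj x y) (hxz : X.Adj x z) :
    ((edgeHyp hxy).carrier ∩ (edgeHyp hxz).carrier).Nonempty :=
  ⟨x, ⟨s(x, y), ⟨hxy, rfl⟩, Sym2.mem_mk_left x y⟩, ⟨s(x, z), ⟨hxz, rfl⟩, Sym2.mem_mk_left x z⟩⟩

variable {G I : Type*} [Group G] {ρ : G →* (X ≃g X)} {J : I → Hyperplane X}

variable (ρ J) in
/-- `x y` is an edge whose hyperplane is a translate of `J i`. -/
def HasType (x y : V) (i : I) : Prop := ∃ h : X.Adj x y, ∃ g : G, edgeHyp h = ρ g • J i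

lemma HasType.symm {x y : V} {i : I} (h : HasType ρ J x y i) : HasType ρ J y x i := by
  obtain ⟨h, g, e⟩ := h
  exact ⟨h.symm, g, (edgeHyp_symm h).trans e⟩

lemma HasType.opposite {a b c d : V} {i : I} (h : IsSquare X a b c d)
    (ht : HasType ρ J a b i) : HasType ρ J d c i := by
  obtain ⟨_, g, e⟩ := ht
  exact ⟨h.cd.symm, g, (edgeHyp_square h).symm.trans e⟩

lemma IsRepresentatives.exists_type (hJ : IsRepresentatives ρ J) {x y : V} (h : X.Adj x y) :
    ∃ i, HasType ρ J x y i := by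
  obtain ⟨i, ⟨g, hg⟩, -⟩ := hJ (edgeHyp h)
  exact ⟨i, h, g, hg⟩

lemma IsRepresentatives.type_unique (hJ : IsRepresentatives ρ J) {H : Hyperplane X} {i j : I}
    {g k : G} (hi : H = ρ g • J i) (hj : H = ρ k • J j) : i = j :=
  (hJ H).unique ⟨g, hi⟩ ⟨k, hj⟩

/-- The two hyperplanes are translates of each other with intersecting carriers; if distinct, they
would be transverse or tangent. -/
lemma IsSpecial.edgeHyp_eq (hρ : IsSpecial ρ) {x y z : V} {i : I} (hy : HasType ρ J x y i)
    (hz : HasType ρ J x z i) : edgeHyp hz.1 = edgeHyp hy.1 := by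
  obtain ⟨h1, g, e1⟩ := hy
  obtain ⟨h2, k, e2⟩ := hz
  have e3 : edgeHyp h2 = ρ (k * g⁻¹) • edgeHyp h1 := by
    rw [e1, e2, smul_smul, ← map_mul, inv_mul_cancel_right]
  by_contra hne
  refine hρ.not_tangent (edgeHyp h1) (k * g⁻¹) ⟨?_, hρ.not_transverse _ _, ?_⟩
  · rw [← e3]
    exact fun e => hne e.symm
  · rw [← e3]
    exact carrier_inter_nonempty h1 h2

/-- After translation, the first hyperplane is transverse to some translate of the second, so the
two are not tangent. Being distinct and having intersecting carriers, they are transverse, and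
`exists_square` applies. -/
lemma exists_square_of_adj_types (hX : IsQuasiMedian X) (hρ : IsSpecial ρ)
    (hJ : IsRepresentatives ρ J) {x y z : V} {i j : I} (hy : HasType ρ J x y i)
    (hz : HasType ρ J x z j) (hij : (crossingGraph ρ J).Adj i j) :
    ∃ w, IsSquare X x y w z := by
  obtain ⟨h1, g, e1⟩ := hy
  obtain ⟨h2, k, e2⟩ := hz
  obtain ⟨hne, g', k', ht⟩ := hij
  have e1' : edgeHyp h1 = ρ (g * g'⁻¹) • ρ g' • J i := by
    rw [e1, smul_smul, ← map_mul, inv_mul_cancel_right]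
  have e2' : edgeHyp h2 = ρ (k * k'⁻¹ * (g * g'⁻¹)⁻¹) • ρ (g * g'⁻¹) • ρ k' • J j := by
    rw [e2, smul_smul, smul_smul, ← map_mul, ← map_mul]
    congr 2
    group
  have ht' := ht.smul (ρ (g * g'⁻¹))
  rw [← e1'] at ht'
  refine hX.exists_square h1 h2 ?_
  by_contra hnt
  refine hρ.not_inter_osculate _ _ (k * k'⁻¹ * (g * g'⁻¹)⁻¹) ht' ?_
  rw [← e2']
  exact ⟨fun e => hne (hJ.type_unique e1 (e.trans e2)), hnt, carrier_inter_nonempty h1 h2⟩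

lemma crossingGraph_adj_of_square (hρ : IsSpecial ρ) {a b c d : V} (h : IsSquare X a b c d)
    {i j : I} {g k : G} (hi : edgeHyp h.ab = ρ g • J i) (hj : edgeHyp h.da.symm = ρ k • J j) :
    (crossingGraph ρ J).Adj i j := by
  have ht := transverse_of_square h
  refine ⟨?_, g, k, hi ▸ hj ▸ ht⟩
  rintro rfl
  refine hρ.not_transverse (edgeHyp h.ab) (k * g⁻¹) ?_
  rwa [hi, smul_smul, ← map_mul, inv_mul_cancel_right, ← hi, ← hj]

variable {𝒢 : I → Type*} [∀ i, Group (𝒢 i)] (c : ∀ i, (J i).Sector ≃ 𝒢 i)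

variable (ρ) in
/-- The element of `𝒢 i` which relates the sectors of `ρ g • J i` containing `x` and `y`. -/
def sectorLabel (i : I) (g : G) (x y : V) : 𝒢 i :=
  (c i (sectorMk (J i) (ρ g⁻¹ x)))⁻¹ * c i (sectorMk (J i) (ρ g⁻¹ y))

lemma sectorLabel_mul (i : I) (g : G) (x y z : V) :
    sectorLabel ρ c i g x y * sectorLabel ρ c i g y z = sectorLabel ρ c i g x z := by
  simp [sectorLabel, mul_assoc]

lemma sectorLabel_self (i : I) (g : G) (x : V) : sectorLabel ρ c i g x x = 1 := by
  simp [sectorLabel]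

lemma map_inv_edge {i : I} {g : G} {x y : V} {h : X.Adj x y} (e : edgeHyp h = ρ g • J i) :
    edgeHyp ((ρ g⁻¹).map_adj_iff.2 h) = J i := by
  rw [edgeHyp_map _ h, e, smul_smul, ← map_mul, inv_mul_cancel, map_one, one_smul]

lemma apply_inv_apply (g : G) (x : V) : ρ g⁻¹ (ρ g x) = x := by
  have : (ρ g⁻¹ * ρ g) x = x := by rw [← map_mul, inv_mul_cancel, map_one]; rfl
  exact this

lemma apply_apply_inv (g : G) (x : V) : ρ g (ρ g⁻¹ x) = x := by
  have := apply_inv_apply (ρ := ρ) g⁻¹ x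
  rwa [inv_inv] at this

lemma sectorMk_eq_of_edgeHyp_ne {i : I} {g : G} {x y : V} (h : X.Adj x y)
    (hne : edgeHyp h ≠ ρ g • J i) :
    sectorMk (J i) (ρ g⁻¹ x) = sectorMk (J i) (ρ g⁻¹ y) := by
  refine sectorMk_eq_of_adj ((ρ g⁻¹).map_adj_iff.2 h) fun e => hne ?_
  rw [← e, edgeHyp_map, smul_smul, ← map_mul, mul_inv_cancel, map_one, one_smul]

lemma sectorLabel_ne_one (hX : IsQuasiMedian X) {i : I} {g : G} {x y : V} {h : X.Adj x y}
    (e : edgeHyp h = ρ g • J i) : sectorLabel ρ c i g x y ≠ 1 := by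
  intro h1
  rw [sectorLabel, inv_mul_eq_one, (c i).apply_eq_iff_eq,
    sectorMk_eq_iff hX _ (map_inv_edge e)] at h1
  exact (hX.edgeHyp_eq_iff _ ((ρ g⁻¹).map_adj_iff.2 h)).1 rfl h1

/-- The other two sides of the square do not cross the hyperplane, so they join vertices of the same
sector. -/
lemma sectorLabel_square (hX : IsQuasiMedian X) {i : I} {g : G} {p q r s : V}
    (h : IsSquare X p q r s) (e : edgeHyp h.ab = ρ g • J i) :
    sectorLabel ρ c i g p q = sectorLabel ρ c i g s r := by
  have hne := hX.edgeHyp_ne_of_square h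
  rw [sectorLabel, sectorLabel, sectorMk_eq_of_edgeHyp_ne h.da.symm fun k => hne (e.trans k.symm),
    sectorMk_eq_of_edgeHyp_ne h.bc fun k => hne (e.trans (k.symm.trans (edgeHyp_square' h).symm))]

/-- In a clique dual to a translate of `J i`, all the labels in `𝒢 i` occur. -/
lemma exists_sectorLabel_eq (hX : IsQuasiMedian X) {i : I} {g : G} {x y : V} {h : X.Adj x y}
    (e : edgeHyp h = ρ g • J i) {k : 𝒢 i} (hk : k ≠ 1) :
    ∃ (z : V) (h' : X.Adj x z), edgeHyp h' = ρ g • J i ∧ sectorLabel ρ c i g x z = k := by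
  have e' := map_inv_edge e
  have hadj := (ρ g⁻¹).map_adj_iff.2 h
  -- Surjectivity of `c i` provides the sector with the required label; the gate of any of its
  -- vertices is its representative in the clique.
  obtain ⟨v, hv⟩ : ∃ v, sectorMk (J i) v = (c i).symm (c i (sectorMk (J i) (ρ g⁻¹ x)) * k) :=
    Quot.exists_rep _
  have hm := hX.cliqueGate_mem hadj v
  have hs : sectorMk (J i) (cliqueGate X (ρ g⁻¹ x) (ρ g⁻¹ y) v) = sectorMk (J i) v :=
    (sectorMk_eq_iff hX hadj e').2 (hX.cliqueGate_of_mem hadj hm)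
  have hl : sectorLabel ρ c i g x (ρ g (cliqueGate X (ρ g⁻¹ x) (ρ g⁻¹ y) v)) = k := by
    rw [sectorLabel, apply_inv_apply, hs, hv, Equiv.apply_symm_apply, inv_mul_cancel_left]
  have hne : ρ g⁻¹ x ≠ cliqueGate X (ρ g⁻¹ x) (ρ g⁻¹ y) v := by
    intro he
    rw [← he, apply_apply_inv, sectorLabel_self] at hl
    exact hk hl.symm
  have hadj' := hX.edgeClique_adj hadj (left_mem_edgeClique _ _) hm hne
  have h' : X.Adj x (ρ g (cliqueGate X (ρ g⁻¹ x) (ρ g⁻¹ y) v)) := by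
    have := (ρ g).map_adj_iff.2 hadj'
    rwa [apply_apply_inv] at this
  refine ⟨_, h', ?_, hl⟩
  rw [← e', ← hX.edgeHyp_clique hadj (left_mem_edgeClique _ _) hm hadj', ← edgeHyp_map]
  exact edgeHyp_congr _ _ (by rw [apply_apply_inv])

/-- The identifications `c i` are compatible with the actions of the stabilisers. -/
def IsCompatible (ρ : G →* (X ≃g X)) (c : ∀ i, (J i).Sector ≃ 𝒢 i) : Prop :=
  ∀ i (g : hyperplaneStab ρ (J i)), ∃ s : 𝒢 i, ∀ S, c i (sectorHom ρ (J i) g S) = s * c i S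

variable {c}

/-- Changing the translating element multiplies both sector coordinates on the left by the same s,
which cancels in the quotient. -/
lemma IsCompatible.sectorLabel_eq (hc : IsCompatible ρ c) {i : I} {g k : G}
    (h : ρ g • J i = ρ k • J i) (x y : V) :
    sectorLabel ρ c i g x y = sectorLabel ρ c i k x y := by
  have hmem : k⁻¹ * g ∈ hyperplaneStab ρ (J i) := by
    change ρ (k⁻¹ * g) • J i = J i
    rw [map_mul, mul_smul, h, smul_smul, ← map_mul, inv_mul_cancel, map_one, one_smul]
  obtain ⟨s, hs⟩ := hc i ⟨k⁻¹ * g, hmem⟩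
  have key : ∀ v, sectorMk (J i) (ρ k⁻¹ v) =
      sectorHom ρ (J i) ⟨k⁻¹ * g, hmem⟩ (sectorMk (J i) (ρ g⁻¹ v)) := fun v => by
    change _ = sectorMk (J i) (ρ (k⁻¹ * g) (ρ g⁻¹ v))
    have : ρ (k⁻¹ * g) (ρ g⁻¹ v) = ρ k⁻¹ (ρ g (ρ g⁻¹ v)) := by rw [map_mul]; rfl
    rw [this, apply_apply_inv]
  rw [sectorLabel, sectorLabel, key, key, hs, hs]
  group

open Classical in
/-- The label of an oriented edge, in the graph product. -/
noncomputable def edgeLabel (ρ : G →* (X ≃g X)) (c : ∀ i, (J i).Sector ≃ 𝒢 i) (x y : V) :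
    GraphProduct (crossingGraph ρ J) 𝒢 :=
  -- When `J` is a system of representatives, the value 1 is only taken on non-edges.
  if h : ∃ p : I × G, ∃ h : X.Adj x y, edgeHyp h = ρ p.2 • J p.1 then
    GraphProduct.of _ 𝒢 h.choose.1 (sectorLabel ρ c h.choose.1 h.choose.2 x y) else 1

lemma IsCompatible.edgeLabel_eq (hc : IsCompatible ρ c) (hJ : IsRepresentatives ρ J) {x y : V}
    {h : X.Adj x y} {i : I} {g : G} (e : edgeHyp h = ρ g • J i) :
    edgeLabel ρ c x y = GraphProduct.of _ 𝒢 i (sectorLabel ρ c i g x y) := by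
  have hex : ∃ p : I × G, ∃ h : X.Adj x y, edgeHyp h = ρ p.2 • J p.1 := ⟨(i, g), h, e⟩
  rw [edgeLabel, dif_pos hex]
  obtain ⟨h', e'⟩ := hex.choose_spec
  generalize hex.choose = p at e'
  obtain ⟨j, k⟩ := p
  obtain rfl := hJ.type_unique e e'
  exact congrArg _ (hc.sectorLabel_eq (e'.symm.trans e) x y)

lemma IsCompatible.edgeLabel_map (hc : IsCompatible ρ c) (hJ : IsRepresentatives ρ J) (g : G)
    {x y : V} (h : X.Adj x y) : edgeLabel ρ c (ρ g x) (ρ g y) = edgeLabel ρ c x y := by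
  obtain ⟨i, _, k, e⟩ := hJ.exists_type h
  have e' : edgeHyp ((ρ g).map_adj_iff.2 h) = ρ (g * k) • J i := by
    rw [edgeHyp_map _ h, e, smul_smul, ← map_mul]
  have key : ∀ v, ρ (g * k)⁻¹ (ρ g v) = ρ k⁻¹ v := fun v => by
    have : ρ (g * k)⁻¹ (ρ g v) = ρ k⁻¹ (ρ g⁻¹ (ρ g v)) := by rw [mul_inv_rev, map_mul]; rfl
    rw [this, apply_inv_apply]
  rw [hc.edgeLabel_eq hJ e, hc.edgeLabel_eq hJ e', sectorLabel, sectorLabel, key, key]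

/-- The vertices of `X` can be mapped to the graph product in such a way that the edges have the
prescribed labels. -/
lemma IsCompatible.exists_map (hc : IsCompatible ρ c) (hX : IsQuasiMedian X) (hρ : IsSpecial ρ)
    (hJ : IsRepresentatives ρ J) : ∃ Φ : V → GraphProduct (crossingGraph ρ J) 𝒢,
      ∀ x y, X.Adj x y → Φ y = Φ x * edgeLabel ρ c x y := by
  refine hX.exists_potential _ ?_ ?_ ?_
  · intro x y h
    obtain ⟨i, _, g, e⟩ := hJ.exists_type h
    rw [hc.edgeLabel_eq hJ e, hc.edgeLabel_eq hJ ((edgeHyp_symm h).trans e), ← map_mul,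
      sectorLabel_mul, sectorLabel_self, map_one]
  · intro x y z hxy hyz hxz
    obtain ⟨i, _, g, e⟩ := hJ.exists_type hxy
    have e1 := (edgeHyp_triangle hxy hyz hxz).symm.trans e
    have e2 := (edgeHyp_triangle hyz hxz.symm hxy.symm).trans ((edgeHyp_symm hxy).trans e)
    rw [hc.edgeLabel_eq hJ e, hc.edgeLabel_eq hJ e1, hc.edgeLabel_eq hJ e2, ← map_mul,
      sectorLabel_mul]
  · intro p q r s h
    obtain ⟨i, _, g, e1⟩ := hJ.exists_type h.ab
    obtain ⟨j, _, k, e2⟩ := hJ.exists_type h.da.symm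
    rw [hc.edgeLabel_eq hJ e1, hc.edgeLabel_eq hJ e2,
      hc.edgeLabel_eq hJ ((edgeHyp_square h).symm.trans e1),
      hc.edgeLabel_eq hJ ((edgeHyp_square' h).symm.trans e2),
      ← sectorLabel_square c hX h e1, ← sectorLabel_square c hX h.reflect e2]
    exact GraphProduct.commute_of (crossingGraph_adj_of_square hρ h e1 e2) _ _

end Labels

/-! ### The embedding and its gates. -/

section Embedding

open GraphProduct

variable {V G I : Type*} {X : SimpleGraph V} [Group G] {ρ : G →* (X ≃g X)}
  {J : I → Hyperplane X} {𝒢 : I → Type*} [∀ i, Group (𝒢 i)] {c : ∀ i, (J i).Sector ≃ 𝒢 i}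

/-- If `x` is a vertex of `X` whose image is as close as possible to `h`, then the distance
from `h` to the image of `y` is the sum of its distance to the image of `x` and of `d(x, y)`;
moreover, every head available on an edge at `y` is carried by an edge pointing towards `x`. -/
lemma IsCompatible.len_eq_and_exists (hc : IsCompatible ρ c) (hX : IsQuasiMedian X)
    (hρ : IsSpecial ρ) (hJ : IsRepresentatives ρ J)
    {Φ : V → GraphProduct (crossingGraph ρ J) 𝒢}
    (hΦ : ∀ x y, X.Adj x y → Φ y = Φ x * edgeLabel ρ c x y)
    {h : GraphProduct (crossingGraph ρ J) 𝒢} {x : V}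
    (hx : ∀ y, len _ 𝒢 ((Φ x)⁻¹ * h) ≤ len _ 𝒢 ((Φ y)⁻¹ * h)) : ∀ (n : ℕ) (y : V),
      X.dist x y = n → len _ 𝒢 ((Φ y)⁻¹ * h) = n + len _ 𝒢 ((Φ x)⁻¹ * h) ∧
      ∀ (u : I) (z : V), HasType ρ J y z u → HasHead u ((Φ y)⁻¹ * h) →
        ∃ t, HasType ρ J y t u ∧ X.dist x t + 1 = X.dist x y := by
  intro n
  induction n with
  | zero =>
    intro y hy
    obtain rfl := hX.connected.dist_eq_zero_iff.1 hy
    refine ⟨(Nat.zero_add _).symm, fun u z hz hu => ?_⟩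
    exfalso
    obtain ⟨k, r, e, hr⟩ := hu.exists_eq
    have hk : k ≠ 1 := by
      rintro rfl
      rw [map_one, one_mul] at e
      rw [e] at hr
      omega
    obtain ⟨h0, g, e0⟩ := hz
    obtain ⟨t, h1, e1, hl⟩ := exists_sectorLabel_eq c hX e0 hk
    have h2 := hx t
    rw [hΦ x t h1, hc.edgeLabel_eq hJ e1, hl, mul_inv_rev, mul_assoc, e, inv_mul_cancel_left,
      ← e] at h2
    omega
  | succ n ih =>
    intro y hy
    have hne : x ≠ y := by
      rintro rfl
      rw [SimpleGraph.dist_self] at hy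
      omega
    obtain ⟨y₁, hadj, hd⟩ := hX.exists_closer hne
    obtain ⟨ih1, ih2⟩ := ih y₁ (by omega)
    obtain ⟨v, hv⟩ := hJ.exists_type hadj
    obtain ⟨_, g, e⟩ := id hv
    have hk := sectorLabel_ne_one c hX e
    have hmul : (Φ y)⁻¹ * h = of _ 𝒢 v (sectorLabel ρ c v g y y₁) * ((Φ y₁)⁻¹ * h) := by
      rw [hΦ y y₁ hadj, hc.edgeLabel_eq hJ e, mul_inv_rev, mul_assoc, mul_inv_cancel_left]
    -- Otherwise an edge of type v descends from y₁ to some y₂; being in the same hyperplane as the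
    -- edge to y, it puts y in a clique with y₂, hence too close to x.
    have hhead : ¬ HasHead v ((Φ y₁)⁻¹ * h) := by
      intro hh
      obtain ⟨y₂, h2, hd2⟩ := ih2 v y hv.symm hh
      rcases hX.eq_or_adj_of_edgeHyp_eq hv.symm.1 h2.1 (hρ.edgeHyp_eq hv.symm h2) with rfl | h3
      · omega
      · have := hX.dist_le_succ x h3.symm
        omega
    rw [hmul]
    refine ⟨by rw [len_of_mul hk hhead]; omega, fun u z hz hu => ?_⟩
    by_cases huv : u = v
    · subst huv
      exact ⟨y₁, hv, hd⟩
    obtain ⟨huv', hu'⟩ := hu.of_of_mul hk hhead huv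
    -- The head u commutes with v: its edge is carried across a square to y₁, replaced there by a
    -- descending one, and carried back to y.
    obtain ⟨w, hw⟩ := exists_square_of_adj_types hX hρ hJ hz hv huv'
    obtain ⟨y₂, h2, hd2⟩ := ih2 u w (hz.opposite hw) hu'
    obtain ⟨t, ht⟩ := exists_square_of_adj_types hX hρ hJ h2 hv.symm huv'
    refine ⟨t, h2.opposite ht, ?_⟩
    have h3 := hX.dist_le_succ x ht.bc
    have h4 := hX.dist_le_succ x ht.cd
    omega

/-- A special action on a quasi-median graph embeds into the action of a graph product on its
quasi-median graph. -/
theorem IsCompatible.exists_embedding (hc : IsCompatible ρ c) (hX : IsQuasiMedian X)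
    (hρ : IsSpecial ρ) (hJ : IsRepresentatives ρ J) :
    ∃ (φ : G →* GraphProduct (crossingGraph ρ J) 𝒢)
      (Φ : X ↪g graphProductQM (crossingGraph ρ J) 𝒢),
      Function.Injective φ ∧ (∀ (g : G) (x : V), Φ (ρ g x) = φ g * Φ x) ∧
      (∀ x y : V, (graphProductQM (crossingGraph ρ J) 𝒢).dist (Φ x) (Φ y) = X.dist x y) ∧
      IsGated (graphProductQM (crossingGraph ρ J) 𝒢) (Set.range Φ) := by
  obtain ⟨Φ, hΦ⟩ := hc.exists_map hX hρ hJ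
  have := hX.connected.nonempty
  have hgate : ∀ h, ∃ x, (∀ y, len _ 𝒢 ((Φ x)⁻¹ * h) ≤ len _ 𝒢 ((Φ y)⁻¹ * h)) ∧
      ∀ y, (graphProductQM (crossingGraph ρ J) 𝒢).dist (Φ y) h =
        X.dist x y + (graphProductQM (crossingGraph ρ J) 𝒢).dist (Φ x) h := by
    intro h
    obtain ⟨x, -, hx⟩ := (measure fun x => len _ 𝒢 ((Φ x)⁻¹ * h)).wf.has_min Set.univ
      Set.univ_nonempty
    have hx' : ∀ y, len _ 𝒢 ((Φ x)⁻¹ * h) ≤ len _ 𝒢 ((Φ y)⁻¹ * h) :=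
      fun y => Nat.le_of_not_lt (hx y (Set.mem_univ y))
    refine ⟨x, hx', fun y => ?_⟩
    rw [dist_eq_len, dist_eq_len]
    exact (hc.len_eq_and_exists hX hρ hJ hΦ hx' _ y rfl).1
  have hiso : ∀ x y : V, (graphProductQM (crossingGraph ρ J) 𝒢).dist (Φ x) (Φ y) =
      X.dist x y := by
    intro x y
    -- The distance from Φ y to itself is 0, which forces the minimiser z to be y.
    obtain ⟨z, -, hz⟩ := hgate (Φ y)
    have h1 := hz y
    rw [SimpleGraph.dist_self] at h1
    obtain rfl : z = y := hX.connected.dist_eq_zero_iff.1 (by omega)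
    have h2 := hz x
    rw [SimpleGraph.dist_self, SimpleGraph.dist_comm (u := z)] at h2
    exact h2
  have hinj : Function.Injective Φ := fun x y h => by
    rw [← hX.connected.dist_eq_zero_iff, ← hiso, h, SimpleGraph.dist_self]
  obtain ⟨o⟩ := hX.connected.nonempty
  have hequiv : ∀ (g : G) (x : V), Φ (ρ g x) = Φ (ρ g o) * (Φ o)⁻¹ * Φ x := by
    intro g x
    obtain ⟨p⟩ := hX.connected.preconnected o x
    induction p with
    | nil => rw [inv_mul_cancel_right]
    | @cons a b z hab p ih =>
      rw [ih, hΦ _ _ ((ρ g).map_adj_iff.2 hab), hΦ _ _ hab, hc.edgeLabel_map hJ g hab]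
      group
  -- The potential is not normalised at o, hence the correction by the inverse of Φ o.
  refine ⟨MonoidHom.mk' (fun g => Φ (ρ g o) * (Φ o)⁻¹) fun g k => ?_,
    ⟨⟨Φ, hinj⟩, ?_⟩, ?_, hequiv, hiso, ?_⟩
  · have h1 := hequiv g (ρ k o)
    have h2 : ρ (g * k) o = ρ g (ρ k o) := by rw [map_mul]; rfl
    rw [h2, h1]
    group
  · intro x y
    change (graphProductQM (crossingGraph ρ J) 𝒢).Adj (Φ x) (Φ y) ↔ X.Adj x y
    rw [← SimpleGraph.dist_eq_one_iff_adj, hiso, SimpleGraph.dist_eq_one_iff_adj]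
  · rw [injective_iff_map_eq_one]
    intro g hg
    refine (injective_iff_map_eq_one ρ).1 hρ.faithful g (RelIso.ext fun x => hinj ?_)
    have hg' : Φ (ρ g o) * (Φ o)⁻¹ = 1 := hg
    rw [hequiv, hg', one_mul]
    rfl
  · intro h
    obtain ⟨x, -, hx⟩ := hgate h
    refine ⟨Φ x, ⟨x, rfl⟩, ?_⟩
    rintro _ ⟨y, rfl⟩
    obtain ⟨p, hp⟩ := qm_connected.exists_walk_length_eq_dist h (Φ x)
    obtain ⟨q, hq⟩ := qm_connected.exists_walk_length_eq_dist (Φ x) (Φ y)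
    refine ⟨p.append q, ?_, ?_⟩
    · change _ = (graphProductQM (crossingGraph ρ J) 𝒢).dist h (Φ y)
      rw [SimpleGraph.Walk.length_append, hp, hq, hiso, SimpleGraph.dist_comm (u := h),
        SimpleGraph.dist_comm (u := h), hx y, add_comm]
    · exact (SimpleGraph.Walk.mem_support_append_iff _ _).2 (Or.inl p.end_mem_support)

end Embedding
end QuasiMedian

open QuasiMedian
theorem mainTheorem2 {V G I : Type*} [Group G] (X : SimpleGraph V) (hX : IsQuasiMedian X)
    (ρ : G →* (X ≃g X)) (hρ : IsSpecial ρ)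
    (J : I → Hyperplane X) (hJ : IsRepresentatives ρ J)
    (K : I → Type*) [∀ i, Group (K i)]
    (hK : ∀ i, Nonempty (K i ≃ SectorOrbits ρ (J i))) :
    ∃ (φ : G →* GraphProduct (crossingGraph ρ J) (fun i => sectorGroup ρ (J i) × K i))
      (Φ : X ↪g graphProductQM (crossingGraph ρ J) (fun i => sectorGroup ρ (J i) × K i)),
      Function.Injective φ ∧
      (∀ (g : G) (x : V), Φ (ρ g x) = φ g * Φ x) ∧
      (∀ x y : V, (graphProductQM (crossingGraph ρ J)
        (fun i => sectorGroup ρ (J i) × K i)).dist (Φ x) (Φ y) = X.dist x y) ∧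
      IsGated (graphProductQM (crossingGraph ρ J) (fun i => sectorGroup ρ (J i) × K i))
        (Set.range Φ) := by
  have h := fun i => exists_equiv_of_free (sectorGroup ρ (J i)) (hρ.free (J i)) (hK i).some
  choose c hc using h
  refine IsCompatible.exists_embedding (c := c) (fun i g => ?_) hX hρ hJ
  -- The stabiliser moves only the first coordinate, so the trivial element of `K i` suffices and
  -- its group structure may be arbitrary.
  refine ⟨(⟨sectorHom ρ (J i) g, g, rfl⟩, 1), fun S => ?_⟩
  exact (hc i ⟨sectorHom ρ (J i) g, g, rfl⟩ S).trans (Prod.ext rfl (one_mul _).symm)
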